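/- A Boolean constraint language $\Gamma$ is a set of relations $R\subseteq\{0,1\}^r$ ($r\in\mathbb N$); a formula over $\Gamma$ is a finite multiset of constraints $R(v_1,\dots,v_r)$ with $R\in\Gamma$ (variables may repeat). The cost $f_{\mathcal F}(\alpha)$ of an assignment $\alpha$ is the number of constraints of $\mathcal F$ that $\alpha$ violates. Let $R\subseteq\{0,1\}^r$. We say that $\Gamma$ *proportionally implements* $R$ if there are a formula $\mathcal F$ over $\Gamma$ on variables $X\cup Y$ with $|X|=r$ and a constant $c\in\mathbb N$, $c>0$, such that for every $X\in\{0,1\}^r$ the minimum $\min_Y f_{\mathcal F}(X,Y)$ equals $0$ if $X\in R$ and $c$ if $X\notin R$. We say that $\Gamma$ *supports crisp* $R$ if for every $k\in\mathbb N$ there is a formula $\mathcal F$ over $\Gamma$ on variables $X\cup Y$ with $|X|=r$ such that $\min_Y f_{\mathcal F}(X,Y)=0$ for every $X\in R$ and $\min_Y f_{\mathcal F}(X,Y)>k$ for every $X\notin R$. In the problem Weighted Min SAT$(\Gamma)$ the input consists of a formula $\mathcal F$ over $\Gamma$, a weight function $\omega:\mathcal F\to\mathbb Z_{+}$ and integers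 $k,W\ge 0$ (with relations written as truth tables, weights and $W$ in binary). The parameter is $k$. The question is whether there is a set $Z\subseteq\mathcal F$ of at most $k$ constraints, of total weight at most $W$, such that $\mathcal F-Z$ is satisfiable. The problem is called *trivial* if every non-empty $R\in\Gamma$ contains the all-zero tuple, or every non-empty $R\in\Gamma$ contains the all-one tuple. A parameterized problem is W[1]-hard if every problem in W[1] (the class of parameterized problems with an fpt-reduction to Clique, parameterized by the clique size) has an fpt-reduction to it. Here an fpt-reduction is a many-one reduction $(x,k)\mapsto(x',k')$ computable in time $f(k)\cdot|x|^{c}$ with $k'\le g(k)$, for computable functions $f,g$ and a constant $c$. **Lemma.** Let $\Gamma$ be a Boolean constraint language that proportionally implements $(x\to y)$ or proportionally implements $(x=y)$, and that supports crisp $(\neg x\vee\neg y\vee\neg z)$. Then Weighted Min SAT$(\Gamma)$ is trivial or W[1]-hard. -/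

import Mathlib

namespace MinSAT

/-! ### A model of computation with a step count -/

/-- Finite binary trees: the data (inputs, outputs, configurations) of the computation model. -/
inductive Data : Type
  | nil : Data
  | pair (a b : Data) : Data

namespace Data

/-- The number of nodes of a tree, counting leaves. -/
def size : Data → ℕ
  | nil => 1
  | pair a b => size a + size b + 1

def fst : Data → Data
  | nil => nil
  | pair a _ => a

def snd : Data → Data
  | nil => nil
  | pair _ b => b

/-- `false` is `nil`; `true` is a tree different from `nil`. -/
def ofBool : Bool → Data
  | false => nil
  | true => pair nil nil

/-- A list `[a, b, …]` as the tree `(a, (b, …))`. -/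
def ofList : List Data → Data
  | [] => nil
  | a :: l => pair a (ofList l)

/-- Unary numerals. -/
def ofNat (n : ℕ) : Data := ofList (List.replicate n nil)

/-- Binary numerals, least significant bit first. -/
def ofNatBin (n : ℕ) : Data := ofList (n.bits.map ofBool)

end Data

/-- Programs on trees: every program transforms one tree into another one. -/
inductive Prog : Type
  | id : Prog
  | nil : Prog
  | fst : Prog
  | snd : Prog
  /-- Run both programs on the same input and pair the results. -/
  | pair (p q : Prog) : Prog
  /-- Run `p`, then `q` on its output. -/
  | seq (p q : Prog) : Prog
  /-- If `c` gives a tree different from `nil`, run `p`, otherwise run `q`. -/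
  | ite (c p q : Prog) : Prog
  /-- While `c` gives a tree different from `nil`, replace the current tree by its image
  under `p`. -/
  | loop (c p : Prog) : Prog

open Data in
/-- `Runs p x y t`: on input `x`, the program `p` halts with output `y` after `t` steps.
Every operation is charged the number of nodes it reads, copies or writes, so that
a computation of `t` steps can be simulated by a Turing machine in time polynomial in `t` and
the size of the input; conversely, a Turing machine (its configuration stored as a state and two
lists of symbols) is simulated with polynomial overhead. -/
inductive Runs : Prog → Data → Data → ℕ → Prop
  | id (x : Data) : Runs .id x x x.size
  | nil (x : Data) : Runs .nil x .nil 1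
  | fst (x : Data) : Runs .fst x x.fst x.size
  | snd (x : Data) : Runs .snd x x.snd x.size
  | pair {p q : Prog} {x y z : Data} {s t : ℕ} (hp : Runs p x y s) (hq : Runs q x z t) :
      Runs (.pair p q) x (.pair y z) (s + t + x.size + (Data.pair y z).size)
  | seq {p q : Prog} {x y z : Data} {s t : ℕ} (hp : Runs p x y s) (hq : Runs q y z t) :
      Runs (.seq p q) x z (s + t + 1)
  | ite_pos {c p q : Prog} {x b y : Data} {s t : ℕ} (hc : Runs c x b s) (hb : b ≠ .nil)
      (hp : Runs p x y t) : Runs (.ite c p q) x y (s + t + x.size)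
  | ite_neg {c p q : Prog} {x y : Data} {s t : ℕ} (hc : Runs c x .nil s)
      (hq : Runs q x y t) : Runs (.ite c p q) x y (s + t + x.size)
  | loop_done {c p : Prog} {x : Data} {s : ℕ} (hc : Runs c x .nil s) :
      Runs (.loop c p) x x (s + x.size)
  | loop_step {c p : Prog} {x b y z : Data} {s t u : ℕ} (hc : Runs c x b s) (hb : b ≠ .nil)
      (hp : Runs p x y t) (hl : Runs (.loop c p) y z u) :
      Runs (.loop c p) x z (s + t + u + x.size)

/-! ### Parameterized problems, fpt-reductions and W[1] -/

/-- A parameterized problem: the set of its yes-instances `(x, k)`, with parameter `k`. -/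
abbrev ParamProblem := Set (Data × ℕ)

/-- There is a many-one fpt-reduction `r` from `P` to `Q`: it preserves yes- and no-instances,
is computed in time `f(k) · |x|^c`, and the new parameter is at most `g(k)`, for computable
functions `f`, `g` and a constant `c`. -/
def FPTReducible (P Q : ParamProblem) : Prop :=
  ∃ (r : Data → ℕ → Data × ℕ) (p : Prog) (f g : ℕ → ℕ) (c : ℕ), Computable f ∧ Computable g ∧
    ∀ (x : Data) (k : ℕ),
      (∃ t ≤ f k * x.size ^ c,
        Runs p (.pair x (.ofNat k)) (.pair (r x k).1 (.ofNat (r x k).2)) t) ∧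
      (r x k).2 ≤ g k ∧
      ((x, k) ∈ P ↔ r x k ∈ Q)

open Classical in
/-- A graph on `{0, …, n - 1}`, encoded by the rows of its adjacency matrix. -/
noncomputable def encodeGraph {n : ℕ} (G : SimpleGraph (Fin n)) : Data :=
  .ofList (List.ofFn fun i => .ofList (List.ofFn fun j => .ofBool (decide (G.Adj i j))))

/-- The problem Clique: does the graph contain a clique on `k` vertices? Parameter: `k`. -/
def clique : ParamProblem :=
  {I | ∃ (n : ℕ) (G : SimpleGraph (Fin n)), I.1 = encodeGraph G ∧
    ∃ S : Finset (Fin n), G.IsNClique I.2 S}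

/-- The class W[1]: the parameterized problems that are fpt-reducible to Clique. -/
def W1 : Set ParamProblem := {P | FPTReducible P clique}

/-- `Q` is W[1]-hard: every problem in W[1] is fpt-reducible to `Q`. -/
def W1Hard (Q : ParamProblem) : Prop := ∀ P ∈ W1, FPTReducible P Q

/-! ### Boolean constraint languages -/

/-- A Boolean constraint language: a set of Boolean relations, each with its arity. -/
abbrev Language := Set (Σ r : ℕ, Set (Fin r → Bool))

/-- A constraint `R(v₁, …, v_r)` on variables from `V` (variables may be repeated). -/
structure Constraint (V : Type) where
  arity : ℕ
  rel : Set (Fin arity → Bool)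
  scope : Fin arity → V

/-- The constraint uses a relation of the language. -/
def Constraint.Over {V : Type} (c : Constraint V) (Γ : Language) : Prop :=
  (⟨c.arity, c.rel⟩ : Σ r : ℕ, Set (Fin r → Bool)) ∈ Γ

/-- The constraint is satisfied by the assignment. -/
def Constraint.Sat {V : Type} (c : Constraint V) (α : V → Bool) : Prop :=
  (fun i => α (c.scope i)) ∈ c.rel

/-- A formula: a finite collection of constraints, in which a constraint may occur repeatedly. -/
abbrev Formula (V : Type) := List (Constraint V)

open Classical in
/-- The cost function `f_R` of a relation `R`. -/
noncomputable def relCost {r : ℕ} (R : Set (Fin r → Bool)) (x : Fin r → Bool) : ℕ :=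
  if x ∈ R then 0 else 1

/-- The cost `f_F(α)`: the number of constraints of `F` that are violated by `α`. -/
noncomputable def Formula.cost {V : Type} (F : Formula V) (α : V → Bool) : ℕ :=
  (F.map fun c => relCost c.rel fun i => α (c.scope i)).sum

/-- `Γ` proportionally implements the cost function `f`: there are a formula `F` over `Γ` on the
variables `X ∪ Y` and a constant `c > 0` with `c · f(X) = min_Y f_F(X, Y)` for every `X`. -/
def ProportionallyImplementsCost (Γ : Language) {r : ℕ} (f : (Fin r → Bool) → ℕ) : Prop :=
  ∃ (m : ℕ) (F : Formula (Fin r ⊕ Fin m)) (c : ℕ), (∀ C ∈ F, C.Over Γ) ∧ 0 < c ∧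
    ∀ x : Fin r → Bool,
      IsLeast (Set.range fun y : Fin m → Bool => F.cost (Sum.elim x y)) (c * f x)

/-- `Γ` proportionally implements the relation `R`. -/
def ProportionallyImplements (Γ : Language) {r : ℕ} (R : Set (Fin r → Bool)) : Prop :=
  ProportionallyImplementsCost Γ (relCost R)

/-- `Γ` supports crisp constraints `R(X)`: for every `k` there is a formula over `Γ` on the
variables `X ∪ Y` whose cost, minimized over `Y`, is `0` on `R` and exceeds `k` outside `R`. -/
def SupportsCrisp (Γ : Language) {r : ℕ} (R : Set (Fin r → Bool)) : Prop :=
  ∀ k : ℕ, ∃ (m : ℕ) (F : Formula (Fin r ⊕ Fin m)), (∀ C ∈ F, C.Over Γ) ∧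
    ∀ x : Fin r → Bool,
      (x ∈ R → ∃ y : Fin m → Bool, F.cost (Sum.elim x y) = 0) ∧
      (x ∉ R → ∀ y : Fin m → Bool, k < F.cost (Sum.elim x y))

/-- The relation `(x → y)`. -/
def implies : Set (Fin 2 → Bool) := {t | t 0 = true → t 1 = true}

/-- The relation `(x = y)`. -/
def equal : Set (Fin 2 → Bool) := {t | t 0 = t 1}

/-- The relation `(¬x ∨ ¬y ∨ ¬z)`. -/
def negClause3 : Set (Fin 3 → Bool) := {t | t 0 = false ∨ t 1 = false ∨ t 2 = false}

/-! ### Weighted Min SAT -/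

/-- A weighted formula: every constraint comes with a positive integer weight. -/
abbrev WFormula := List (Constraint ℕ × ℕ+)

/-- There is a deletion set `Z` of at most `k` constraints, of total weight at most `W`, such that
the remaining constraints are simultaneously satisfiable. -/
def WFormula.HasDeletionSet (F : WFormula) (k W : ℕ) : Prop :=
  ∃ Z : Finset (Fin F.length), Z.card ≤ k ∧ ∑ i ∈ Z, ((F.get i).2 : ℕ) ≤ W ∧
    ∃ α : ℕ → Bool, ∀ i ∉ Z, (F.get i).1.Sat α

open Classical in
/-- A relation of arity `r`, encoded by its truth table in the form of the complete binary
decision tree of depth `r`. -/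
noncomputable def encodeRel : (r : ℕ) → Set (Fin r → Bool) → Data
  | 0, R => .ofBool (decide (Fin.elim0 ∈ R))
  | r + 1, R =>
      .pair (encodeRel r {t | Fin.cons (α := fun _ => Bool) false t ∈ R})
        (encodeRel r {t | Fin.cons (α := fun _ => Bool) true t ∈ R})

/-- A constraint is encoded by its relation and the list of its variables (numbered in unary). -/
noncomputable def encodeConstraint (c : Constraint ℕ) : Data :=
  .pair (encodeRel c.arity c.rel) (.ofList (List.ofFn fun i => .ofNat (c.scope i)))

/-- An instance without its parameter: the constraints with their weights, and the weight budget.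
Weights are written in binary. -/
noncomputable def encodeInstance (F : WFormula) (W : ℕ) : Data :=
  .pair (.ofList (F.map fun c => .pair (encodeConstraint c.1) (.ofNatBin c.2))) (.ofNatBin W)

/-- The problem Weighted Min SAT(Γ): given a weighted formula `F` over `Γ` and budgets `k`, `W`,
is there a deletion set of cardinality at most `k` and weight at most `W`? Parameter: `k`. -/
def weightedMinSAT (Γ : Language) : ParamProblem :=
  {I | ∃ (F : WFormula) (W : ℕ), I.1 = encodeInstance F W ∧ (∀ c ∈ F, c.1.Over Γ) ∧
    F.HasDeletionSet I.2 W}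

/-- Weighted Min SAT(Γ) is trivial: every non-empty relation of `Γ` contains the all-zero tuple, or
every non-empty relation of `Γ` contains the all-one tuple. (Then a constant assignment violates
only the constraints that no assignment satisfies.) -/
def IsTrivial (Γ : Language) : Prop :=
  (∀ R ∈ Γ, R.2.Nonempty → (fun _ => false) ∈ R.2) ∨
    (∀ R ∈ Γ, R.2.Nonempty → (fun _ => true) ∈ R.2)

end MinSAT

/-! ### Sizes of trees and running times -/

namespace MinSAT

/-! W[1] is defined by reductions to Clique and fpt-reductions compose, so it suffices to reduce
Clique to Weighted Min SAT(Γ) for non-trivial Γ.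

The language supplies three gadgets (`Gadgets`). Two implications in opposite directions implement
equality at a fixed cost per violation, giving soft weighted equations. The formula for the ternary
negative clause, repeated more often than the deletion budget allows, gives a hard clause. A
non-empty relation without the all-zero tuple forces variables to be true, once the variable 0 is
forced to be false by the clause on (0, 0, 0). Thus Weighted Min SAT(Γ) expresses cut instances
(`hasDeletionSet_formula_iff`).

Clique becomes a cut instance as follows. Each ordered pair p = (i, j) of indices below k has two
chains of n² soft equations, one running from true to false, the other from false to true. The
budget of 2k² violations leaves exactly one cut in each chain, at P and Q say, of weights n² - P and
Q + 1. Hard clauses give P ≤ Q, so the weights sum to at least n² + 1, and the total budget k²(n² +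
1) forces P = Q. The common position u * n + v encodes a choice of vertices u, v for i, j. Two
literals now recognise the cut position, and the third literal of a clause can act on it: it forbids
non-edges and ties the chains of (i, j) to those of (i, i) and (j, j), so that all pairs agree on
one vertex for each index (`exists_clique_of_solution`, `exists_solution_of_clique`).

The remaining work shows that the map is computed in polynomial time in the given machine model,
through closure properties of `PolyTime` built on bounded folds. -/

theorem Data.size_pos (x : Data) : 0 < x.size := by
  cases x <;> simp [Data.size]

theorem Data.size_fst_le (x : Data) : x.fst.size ≤ x.size := by
  cases x <;> simp [Data.size, Data.fst]; omega

theorem Data.size_snd_le (x : Data) : x.snd.size ≤ x.size := by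
  cases x <;> simp [Data.size, Data.snd]; omega

/-- Every rule charges for the output it writes. This turns each time bound into a bound on the size
of intermediate results. -/
theorem Runs.size_le {p : Prog} {x y : Data} {t : ℕ} (h : Runs p x y t) : y.size ≤ t := by
  induction h with
  | id x => exact le_rfl
  | nil x => simp [Data.size]
  | fst x => exact x.size_fst_le
  | snd x => exact x.size_snd_le
  | _ => omega

/-! ### Transitivity of fpt-reductions -/

/-- The bounds in an fpt-reduction need not be monotone in the parameter; a sum over an initial
segment is a computable bound for all parameters in that segment. -/
theorem computable_sum_range {f : ℕ → ℕ} (hf : Computable f) :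
    Computable fun n => ∑ i ∈ Finset.range n, f i := by
  have h : Computable fun n : ℕ =>
      (Nat.rec 0 (fun m s => s + f m) n : ℕ) :=
    Computable.nat_rec (f := fun n : ℕ => n) (g := fun _ => 0)
      (h := fun _ (p : ℕ × ℕ) => p.2 + f p.1) Computable.id (Computable.const 0)
      ((Primrec.nat_add.to_comp.comp (Computable.snd.comp Computable.snd)
        (hf.comp (Computable.fst.comp Computable.snd))).to₂)
  refine h.of_eq fun n => ?_
  induction n with
  | zero => rfl
  | succ n ih => rw [Finset.sum_range_succ, ← ih]

theorem computable_pow_const {f : ℕ → ℕ} (hf : Computable f) (c : ℕ) :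
    Computable fun n => f n ^ c := by
  induction c with
  | zero => simpa using Computable.const 1
  | succ c ih => simpa [pow_succ] using Primrec.nat_mul.to_comp.comp ih hf

theorem FPTReducible.trans {P Q R : ParamProblem} (h₁ : FPTReducible P Q)
    (h₂ : FPTReducible Q R) : FPTReducible P R := by
  obtain ⟨r₁, p₁, f₁, g₁, c₁, hf₁, hg₁, h₁⟩ := h₁
  obtain ⟨r₂, p₂, f₂, g₂, c₂, hf₂, hg₂, h₂⟩ := h₂
  have hF : Computable fun k => ∑ i ∈ Finset.range (g₁ k + 1), f₂ i :=
    (computable_sum_range hf₂).comp (Primrec.succ.to_comp.comp hg₁)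
  have hG : Computable fun k => ∑ i ∈ Finset.range (g₁ k + 1), g₂ i :=
    (computable_sum_range hg₂).comp (Primrec.succ.to_comp.comp hg₁)
  refine ⟨fun x k => r₂ (r₁ x k).1 (r₁ x k).2, .seq p₁ p₂,
    fun k => (∑ i ∈ Finset.range (g₁ k + 1), f₂ i) * f₁ k ^ c₂ + f₁ k + 1,
    fun k => ∑ i ∈ Finset.range (g₁ k + 1), g₂ i, c₁ * c₂ + c₁,
    ?_, hG, fun x k => ?_⟩
  · exact Primrec.succ.to_comp.comp (Primrec.nat_add.to_comp.comp
      (Primrec.nat_mul.to_comp.comp hF (computable_pow_const hf₁ c₂)) hf₁)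
  obtain ⟨⟨t₁, ht₁, hr₁⟩, hk₁, e₁⟩ := h₁ x k
  obtain ⟨⟨t₂, ht₂, hr₂⟩, hk₂, e₂⟩ := h₂ (r₁ x k).1 (r₁ x k).2
  have hmem : (r₁ x k).2 ∈ Finset.range (g₁ k + 1) := by simpa [Nat.lt_succ_iff] using hk₁
  have hf : f₂ (r₁ x k).2 ≤ ∑ i ∈ Finset.range (g₁ k + 1), f₂ i :=
    Finset.single_le_sum (f := f₂) (fun _ _ => Nat.zero_le _) hmem
  have hg : g₂ (r₁ x k).2 ≤ ∑ i ∈ Finset.range (g₁ k + 1), g₂ i :=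
    Finset.single_le_sum (f := g₂) (fun _ _ => Nat.zero_le _) hmem
  refine ⟨⟨_, ?_, Runs.seq hr₁ hr₂⟩, hk₂.trans hg, e₁.trans e₂⟩
  set F := ∑ i ∈ Finset.range (g₁ k + 1), f₂ i
  -- The intermediate instance is no larger than the time spent on writing it.
  have hs : (r₁ x k).1.size ≤ f₁ k * x.size ^ c₁ := by
    have := hr₁.size_le
    simp only [Data.size] at this
    omega
  have hx := x.size_pos
  have h1 : t₂ ≤ F * f₁ k ^ c₂ * x.size ^ (c₁ * c₂) := by
    calc t₂ ≤ F * (f₁ k * x.size ^ c₁) ^ c₂ := ht₂.trans (by gcongr)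
      _ = _ := by rw [mul_pow, ← pow_mul, mul_assoc]
  have h2 : x.size ^ (c₁ * c₂) ≤ x.size ^ (c₁ * c₂ + c₁) := Nat.pow_le_pow_right hx (by omega)
  have h3 : x.size ^ c₁ ≤ x.size ^ (c₁ * c₂ + c₁) := Nat.pow_le_pow_right hx (by omega)
  have h4 : 1 ≤ x.size ^ (c₁ * c₂ + c₁) := Nat.one_le_pow _ _ hx
  calc t₁ + t₂ + 1 ≤ f₁ k * x.size ^ c₁ + F * f₁ k ^ c₂ * x.size ^ (c₁ * c₂) + 1 := by omega
    _ ≤ f₁ k * x.size ^ (c₁ * c₂ + c₁) + F * f₁ k ^ c₂ * x.size ^ (c₁ * c₂ + c₁) +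
        x.size ^ (c₁ * c₂ + c₁) := by gcongr
    _ = _ := by ring

theorem w1Hard_of_clique {Q : ParamProblem} (h : FPTReducible clique Q) : W1Hard Q :=
  fun _ hP => FPTReducible.trans hP h

/-! ### Polynomial bounds -/

/-- The function is bounded by a polynomial. -/
def PolyBound (b : ℕ → ℕ) : Prop := ∃ c : ℕ, ∀ s, b s ≤ (s + 2) ^ c

namespace PolyBound

variable {a b : ℕ → ℕ}

theorem id : PolyBound fun s => s := ⟨1, fun s => by simp⟩

theorem const (n : ℕ) : PolyBound fun _ => n :=
  ⟨n, fun s => (Nat.lt_two_pow_self).le.trans (Nat.pow_le_pow_left (by omega) n)⟩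

theorem mul (ha : PolyBound a) (hb : PolyBound b) : PolyBound fun s => a s * b s := by
  obtain ⟨c, hc⟩ := ha
  obtain ⟨d, hd⟩ := hb
  exact ⟨c + d, fun s => by rw [pow_add]; exact Nat.mul_le_mul (hc s) (hd s)⟩

theorem add (ha : PolyBound a) (hb : PolyBound b) : PolyBound fun s => a s + b s := by
  obtain ⟨c, hc⟩ := ha
  obtain ⟨d, hd⟩ := hb
  refine ⟨c + d + 1, fun s => ?_⟩
  have h1 : (s + 2) ^ c ≤ (s + 2) ^ (c + d) := Nat.pow_le_pow_right (by omega) (by omega)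
  have h2 : (s + 2) ^ d ≤ (s + 2) ^ (c + d) := Nat.pow_le_pow_right (by omega) (by omega)
  have := hc s
  have := hd s
  calc a s + b s ≤ (s + 2) ^ (c + d) * 2 := by omega
    _ ≤ (s + 2) ^ (c + d) * (s + 2) := by gcongr; omega
    _ = _ := (pow_succ _ _).symm

theorem pow (ha : PolyBound a) (n : ℕ) : PolyBound fun s => a s ^ n := by
  obtain ⟨c, hc⟩ := ha
  exact ⟨c * n, fun s => by rw [pow_mul]; exact Nat.pow_le_pow_left (hc s) n⟩

end PolyBound

/-! ### Encodings and polynomial-time functions -/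

/-- Types whose elements are represented by trees. -/
class Enc (α : Type) where
  enc : α → Data

open Enc (enc)

/-- The size of the encoding. -/
def esize {α : Type} [Enc α] (a : α) : ℕ := (enc a).size

instance : Enc Data := ⟨id⟩
instance : Enc Unit := ⟨fun _ => .nil⟩
instance : Enc Bool := ⟨Data.ofBool⟩
-- Unary, like the parameter and the variable names. Binary numerals enter only for weights and the
-- weight budget.
instance : Enc ℕ := ⟨Data.ofNat⟩
instance {α β : Type} [Enc α] [Enc β] : Enc (α × β) := ⟨fun x => .pair (enc x.1) (enc x.2)⟩
instance {α : Type} [Enc α] : Enc (List α) := ⟨fun l => .ofList (l.map enc)⟩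

section Enc

variable {α β : Type} [Enc α] [Enc β]

theorem enc_data (d : Data) : enc d = d := rfl
theorem enc_bool (b : Bool) : enc b = Data.ofBool b := rfl
theorem enc_nat (n : ℕ) : enc n = Data.ofNat n := rfl
theorem enc_prod (a : α) (b : β) : enc (a, b) = .pair (enc a) (enc b) := rfl
theorem enc_nil : enc ([] : List α) = .nil := rfl
theorem enc_cons (a : α) (l : List α) : enc (a :: l) = .pair (enc a) (enc l) := rfl
theorem enc_zero : enc (0 : ℕ) = .nil := rfl
theorem enc_succ (n : ℕ) : enc (n + 1) = .pair .nil (enc n) := rfl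
theorem enc_replicate (n : ℕ) : enc (List.replicate n ()) = enc n := by
  rw [enc_nat, Data.ofNat]
  exact congrArg Data.ofList (by rw [List.map_replicate]; rfl)

theorem esize_pos (a : α) : 0 < esize a := Data.size_pos _
theorem esize_data (d : Data) : esize d = d.size := rfl
@[simp] theorem esize_prod (a : α) (b : β) : esize (a, b) = esize a + esize b + 1 := rfl
@[simp] theorem esize_nil : esize ([] : List α) = 1 := rfl
@[simp] theorem esize_cons (a : α) (l : List α) : esize (a :: l) = esize a + esize l + 1 := rfl

@[simp] theorem esize_nat (n : ℕ) : esize n = 2 * n + 1 := by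
  induction n with
  | zero => rfl
  | succ n ih =>
    have : esize (n + 1) = 1 + esize n + 1 := rfl
    omega

theorem esize_bool_le (b : Bool) : esize b ≤ 3 := by
  cases b <;> simp [esize, enc_bool, Data.ofBool, Data.size]

theorem esize_append (l m : List α) : esize (l ++ m) + 1 = esize l + esize m := by
  induction l with
  | nil => simp; omega
  | cons a l ih => simp; omega

theorem esize_reverse (l : List α) : esize l.reverse = esize l := by
  induction l with
  | nil => rfl
  | cons a l ih =>
    have := esize_append l.reverse [a]
    simp at this ⊢
    omega

theorem esize_le_of_mem {a : α} {l : List α} (h : a ∈ l) : esize a ≤ esize l := by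
  induction h with
  | head l => simp; omega
  | tail b _ ih => simp; omega

theorem length_le_esize (l : List α) : l.length ≤ esize l := by
  induction l with
  | nil => simp
  | cons a l ih => simp; omega

theorem esize_le_of_forall {l : List α} {M : ℕ} (h : ∀ a ∈ l, esize a ≤ M) :
    esize l ≤ l.length * (M + 1) + 1 := by
  induction l with
  | nil => simp
  | cons a l ih =>
    have h1 := h a (by simp)
    have h2 := ih fun b hb => h b (by simp [hb])
    simp only [esize_cons, List.length_cons, Nat.add_mul]
    omega

end Enc

/-- The function is computed on encodings by a program in polynomial time. -/
@[fun_prop]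
def PolyTime {α β : Type} [Enc α] [Enc β] (f : α → β) : Prop :=
  ∃ (p : Prog) (c : ℕ), ∀ a, ∃ t ≤ (esize a + 2) ^ c, Runs p (enc a) (enc (f a)) t

/-! ### Composition, branching and bounded folds in polynomial time -/

namespace PolyTime

variable {α β γ δ : Type} [Enc α] [Enc β] [Enc γ] [Enc δ]

theorem of_bound {f : α → β} {p : Prog} {b : ℕ → ℕ} (hb : PolyBound b)
    (h : ∀ a, ∃ t ≤ b (esize a), Runs p (enc a) (enc (f a)) t) : PolyTime f := by
  obtain ⟨c, hc⟩ := hb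
  exact ⟨p, c, fun a => let ⟨t, ht, hr⟩ := h a; ⟨t, ht.trans (hc _), hr⟩⟩

theorem esize_le {f : α → β} (hf : PolyTime f) :
    ∃ c, ∀ a, esize (f a) ≤ (esize a + 2) ^ c := by
  obtain ⟨p, c, h⟩ := hf
  exact ⟨c, fun a => let ⟨_, ht, hr⟩ := h a; hr.size_le.trans ht⟩

theorem of_eq {f g : α → β} (hf : PolyTime f) (h : ∀ a, f a = g a) : PolyTime g :=
  (funext h : f = g) ▸ hf

/-- A function which does not change the encoding. -/
theorem of_enc {f : α → β} (h : ∀ a, enc (f a) = enc a) : PolyTime f :=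
  of_bound PolyBound.id fun a => ⟨_, le_rfl, by rw [h]; exact Runs.id _⟩

@[fun_prop]
theorem id : PolyTime fun a : α => a := of_enc fun _ => rfl

theorem exists_prog_const (d : Data) : ∃ (p : Prog) (c : ℕ), ∀ x, ∃ t ≤ c * x.size + c,
    Runs p x d t := by
  induction d with
  | nil => exact ⟨.nil, 1, fun x => ⟨1, by omega, Runs.nil x⟩⟩
  | pair a b iha ihb =>
    obtain ⟨p, c, hp⟩ := iha
    obtain ⟨q, d, hq⟩ := ihb
    refine ⟨.pair p q, c + d + (Data.pair a b).size + 1, fun x => ?_⟩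
    obtain ⟨s, hs, hp⟩ := hp x
    obtain ⟨t, ht, hq⟩ := hq x
    refine ⟨_, ?_, Runs.pair hp hq⟩
    nlinarith [Nat.zero_le ((Data.pair a b).size * x.size)]

@[fun_prop]
theorem const (b : β) : PolyTime fun _ : α => b := by
  obtain ⟨p, c, hp⟩ := exists_prog_const (enc b)
  exact of_bound (((PolyBound.const c).mul .id).add (.const c)) fun a => hp (enc a)

@[fun_prop]
theorem comp {g : β → γ} {f : α → β} (hg : PolyTime g) (hf : PolyTime f) :
    PolyTime fun a => g (f a) := by
  obtain ⟨c, hc⟩ := hf.esize_le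
  obtain ⟨p, d, hp⟩ := hf
  obtain ⟨q, e, hq⟩ := hg
  refine of_bound (p := .seq p q) (b := fun s => (s + 2) ^ d + ((s + 2) ^ c + 2) ^ e + 1)
    ?_ fun a => ?_
  · have h := PolyBound.id.add (.const 2)
    exact ((h.pow d).add (((h.pow c).add (.const 2)).pow e)).add (.const 1)
  · obtain ⟨s, hs, hp⟩ := hp a
    obtain ⟨t, ht, hq⟩ := hq (f a)
    refine ⟨_, ?_, Runs.seq hp hq⟩
    have : t ≤ ((esize a + 2) ^ c + 2) ^ e :=
      ht.trans (Nat.pow_le_pow_left (by have := hc a; omega) e)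
    show _ ≤ _ + _ + 1
    omega

@[fun_prop]
theorem prodMk {f : α → β} {g : α → γ} (hf : PolyTime f) (hg : PolyTime g) :
    PolyTime fun a => (f a, g a) := by
  obtain ⟨c, hc⟩ := hf.esize_le
  obtain ⟨c', hc'⟩ := hg.esize_le
  obtain ⟨p, d, hp⟩ := hf
  obtain ⟨q, e, hq⟩ := hg
  have h := PolyBound.id.add (.const 2)
  refine of_bound (p := .pair p q)
    (((((h.pow d).add (h.pow e)).add .id).add (((h.pow c).add (h.pow c')).add (.const 1))))
    fun a => ?_
  obtain ⟨s, hs, hp⟩ := hp a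
  obtain ⟨t, ht, hq⟩ := hq a
  refine ⟨_, ?_, Runs.pair hp hq⟩
  have := hc a
  have := hc' a
  simp only [Data.size]
  simp only [esize] at *
  omega

@[fun_prop]
theorem fst {f : α → β × γ} (hf : PolyTime f) : PolyTime fun a => (f a).1 :=
  comp (g := Prod.fst)
    (of_bound (p := .fst) .id fun _ => ⟨_, le_rfl, Runs.fst _⟩) hf

@[fun_prop]
theorem snd {f : α → β × γ} (hf : PolyTime f) : PolyTime fun a => (f a).2 :=
  comp (g := Prod.snd)
    (of_bound (p := .snd) .id fun _ => ⟨_, le_rfl, Runs.snd _⟩) hf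

@[fun_prop]
theorem cond {c : α → Bool} {f g : α → β} (hc : PolyTime c) (hf : PolyTime f)
    (hg : PolyTime g) : PolyTime fun a => bif c a then f a else g a := by
  obtain ⟨p, i, hp⟩ := hc
  obtain ⟨q, j, hq⟩ := hf
  obtain ⟨r, k, hr⟩ := hg
  have h := PolyBound.id.add (.const 2)
  refine of_bound (p := .ite p q r) ((((h.pow i).add (h.pow j)).add (h.pow k)).add .id)
    fun a => ?_
  obtain ⟨s, hs, hp⟩ := hp a
  obtain ⟨t, ht, hq⟩ := hq a
  obtain ⟨u, hu, hr⟩ := hr a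
  have he : esize a = (enc a).size := rfl
  cases hca : c a with
  | true =>
    rw [hca] at hp
    exact ⟨_, by omega, Runs.ite_pos hp (by simp [enc_bool, Data.ofBool]) hq⟩
  | false =>
    rw [hca] at hp
    exact ⟨_, by omega, Runs.ite_neg hp hr⟩

/-- The program for `List.foldl`: the state of its loop consists of the argument, the remaining
list and the accumulator. -/
theorem runs_foldl {α β γ : Type} [Enc α] [Enc β] [Enc γ] (a : α) (f : γ → β → γ) {pf : Prog}
    {M L T : ℕ} (l : List β) (acc : γ) (hL : esize l ≤ L)
    (hpf : ∀ acc b, esize acc ≤ M → esize b ≤ L →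
      ∃ t ≤ T, Runs pf (enc (a, acc, b)) (enc (f acc b)) t)
    (hM : ∀ l₁, l₁ <+: l → esize (l₁.foldl f acc) ≤ M) :
    ∃ t ≤ (l.length + 1) * (T + 20 * (esize a + M + L) + 80), Runs (.loop (.seq .snd .fst)
      (.pair .fst (.pair (.seq (.seq .snd .fst) .snd)
        (.seq (.pair .fst (.pair (.seq .snd .snd) (.seq (.seq .snd .fst) .fst))) pf))))
      (enc (a, l, acc)) (enc (a, ([] : List β), l.foldl f acc)) t := by
  induction l generalizing acc with
  | nil =>
    refine ⟨_, ?_, Runs.loop_done (Runs.seq (Runs.snd _) (Runs.fst _))⟩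
    have h := hM [] (List.nil_prefix)
    simp only [enc_prod, enc_nil, Data.size, Data.snd, esize, List.foldl_nil,
      List.length_nil] at *
    omega
  | cons b l ih =>
    have h0 := hM [] (List.nil_prefix)
    have h1 := hM [b] ⟨l, rfl⟩
    simp only [List.foldl_nil, List.foldl_cons] at h0 h1
    rw [esize_cons] at hL
    obtain ⟨t, ht, hr⟩ := hpf acc b h0 (by omega)
    obtain ⟨u, hu, hl⟩ := ih (f acc b) (by omega) fun l₁ hl₁ => by
      simpa using hM (b :: l₁) (by simpa using hl₁)
    refine ⟨_, ?_, Runs.loop_step (b := enc (b :: l)) (Runs.seq (Runs.snd _) (Runs.fst _))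
      (by simp [enc_cons])
      (Runs.pair (Runs.fst _) (Runs.pair (Runs.seq (Runs.seq (Runs.snd _) (Runs.fst _))
        (Runs.snd _)) (Runs.seq (Runs.pair (Runs.fst _) (Runs.pair (Runs.seq (Runs.snd _)
          (Runs.snd _)) (Runs.seq (Runs.seq (Runs.snd _) (Runs.fst _)) (Runs.fst _)))) hr))) hl⟩
    rw [List.length_cons, Nat.add_mul (l.length + 1), Nat.one_mul]
    simp only [enc_prod, enc_cons, Data.size, Data.fst, Data.snd, esize] at *
    omega

/-- The source of all loops below. The bound on the accumulator after every prefix is essential: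
iterating a polynomial-time step may otherwise let it grow exponentially. -/
theorem foldl {l : α → List β} {init : α → γ} {f : α → γ → β → γ} (hl : PolyTime l)
    (hi : PolyTime init) (hf : PolyTime fun x : α × γ × β => f x.1 x.2.1 x.2.2)
    {B : ℕ → ℕ} (hB : PolyBound B)
    (hsize : ∀ a l₁, l₁ <+: l a → esize (l₁.foldl (f a) (init a)) ≤ B (esize a)) :
    PolyTime fun a => (l a).foldl (f a) (init a) := by
  obtain ⟨c, hc⟩ := hl.esize_le
  have hstart : PolyTime fun a => (a, l a, init a) := by fun_prop
  obtain ⟨p, d, hp⟩ := hstart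
  obtain ⟨q, e, hq⟩ := hf
  have h := PolyBound.id.add (.const 2)
  -- One step runs on the triple of argument, accumulator and list element; its two pairing nodes
  -- and the 2 in `PolyTime` add up to the 4.
  have hT : PolyBound fun s => (s + B s + (s + 2) ^ c + 4) ^ e :=
    (((PolyBound.id.add hB).add (h.pow c)).add (.const 4)).pow e
  have hloop : PolyBound fun s => ((s + 2) ^ c + 1) *
      ((s + B s + (s + 2) ^ c + 4) ^ e + 20 * (s + B s + (s + 2) ^ c) + 80) :=
    ((h.pow c).add (.const 1)).mul ((hT.add ((PolyBound.const 20).mul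
      ((PolyBound.id.add hB).add (h.pow c)))).add (.const 80))
  refine of_bound (p := .seq p (.seq (.loop (.seq .snd .fst)
      (.pair .fst (.pair (.seq (.seq .snd .fst) .snd)
        (.seq (.pair .fst (.pair (.seq .snd .snd) (.seq (.seq .snd .fst) .fst))) q))))
      (.seq .snd .snd)))
    (((h.pow d).add hloop).add ((((PolyBound.const 2).mul .id).add
      ((PolyBound.const 2).mul hB)).add (.const 20))) fun a => ?_
  obtain ⟨t, ht, hp⟩ := hp a
  obtain ⟨u, hu, hl⟩ := runs_foldl (T := (esize a + B (esize a) + (esize a + 2) ^ c + 4) ^ e)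
    a (f a) (pf := q) (l a) (init a) (hc a)
    (fun acc b hacc hb => by
      obtain ⟨t, ht, hr⟩ := hq (a, acc, b)
      refine ⟨t, ht.trans (Nat.pow_le_pow_left ?_ e), hr⟩
      simp only [esize_prod]
      omega)
    (hsize a)
  refine ⟨_, ?_, Runs.seq hp (Runs.seq hl (Runs.seq (Runs.snd _) (Runs.snd _)))⟩
  have h1 := hsize a (l a) (List.prefix_refl _)
  have h2 : ((l a).length + 1) * ((esize a + B (esize a) + (esize a + 2) ^ c + 4) ^ e +
      20 * (esize a + B (esize a) + (esize a + 2) ^ c) + 80) ≤ ((esize a + 2) ^ c + 1) *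
      ((esize a + B (esize a) + (esize a + 2) ^ c + 4) ^ e +
        20 * (esize a + B (esize a) + (esize a + 2) ^ c) + 80) :=
    Nat.mul_le_mul_right _ (by have := length_le_esize (l a); have := hc a; omega)
  have h3 := hu.trans h2
  clear h2 hu
  generalize ((esize a + 2) ^ c + 1) *
      ((esize a + B (esize a) + (esize a + 2) ^ c + 4) ^ e +
        20 * (esize a + B (esize a) + (esize a + 2) ^ c) + 80) = Q at *
  simp only [enc_prod, enc_nil, Data.size, Data.snd]
  simp only [esize] at *
  omega

end PolyTime

/-- Is the tree `nil`? -/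
def Data.isNil : Data → Bool
  | nil => true
  | pair _ _ => false

/-- Every tree is the encoding of a list. -/
def Data.toList : Data → List Data
  | nil => []
  | pair a b => a :: b.toList

theorem Data.ofList_toList (d : Data) : ofList d.toList = d := by
  induction d with
  | nil => rfl
  | pair a b _ ih => rw [toList, ofList, ih]

theorem Data.toList_ofList (l : List Data) : (ofList l).toList = l := by
  induction l with
  | nil => rfl
  | cons a l ih => rw [ofList, toList, ih]

theorem esize_flatMap_le {β γ : Type} [Enc γ] {f : β → List γ} {l : List β} {M : ℕ}
    (h : ∀ b ∈ l, esize (f b) ≤ M) : esize (l.flatMap f) ≤ l.length * M + 1 := by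
  induction l with
  | nil => simp
  | cons b l ih =>
    have h1 := h b (by simp)
    have h2 := ih fun c hc => h c (by simp [hc])
    have h3 := esize_append (f b) (l.flatMap f)
    rw [List.flatMap_cons, List.length_cons, Nat.add_mul]
    omega

theorem esize_le_of_prefix {β : Type} [Enc β] {l m : List β} (h : l <+: m) :
    esize l ≤ esize m := by
  obtain ⟨r, rfl⟩ := h
  have := esize_append l r
  have := esize_pos r
  omega

/-! ### Polynomial-time operations on trees, Booleans, lists and numbers -/

namespace PolyTime

variable {α β γ : Type} [Enc α] [Enc β] [Enc γ]

theorem enc_apply {f : α → β} (hf : PolyTime f) : PolyTime fun a => enc (f a) :=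
  comp (g := enc) (of_enc fun _ => rfl) hf

@[fun_prop]
theorem dataFst {f : α → Data} (hf : PolyTime f) : PolyTime fun a => (f a).fst :=
  comp (g := Data.fst) (of_bound (p := .fst) .id fun _ => ⟨_, le_rfl, Runs.fst _⟩) hf

@[fun_prop]
theorem dataSnd {f : α → Data} (hf : PolyTime f) : PolyTime fun a => (f a).snd :=
  comp (g := Data.snd) (of_bound (p := .snd) .id fun _ => ⟨_, le_rfl, Runs.snd _⟩) hf

@[fun_prop]
theorem toList {f : α → Data} (hf : PolyTime f) : PolyTime fun a => (f a).toList :=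
  comp (g := Data.toList) (of_enc fun d =>
    (congrArg Data.ofList (List.map_id _)).trans d.ofList_toList) hf

@[fun_prop]
theorem isNil {f : α → Data} (hf : PolyTime f) : PolyTime fun a => (f a).isNil := by
  refine comp (g := Data.isNil) (of_bound (p := .ite .id .nil (.pair .nil .nil))
    (((PolyBound.const 5).mul .id).add (.const 10)) fun d => ?_) hf
  cases d with
  | nil => exact ⟨_, by simp [esize, enc_data, Data.size],
      Runs.ite_neg (Runs.id _) (Runs.pair (Runs.nil _) (Runs.nil _))⟩
  | pair a b => exact ⟨_, by simp [esize, enc_data, Data.size]; omega,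
      Runs.ite_pos (Runs.id _) (by simp [enc_data]) (Runs.nil _)⟩

@[fun_prop]
theorem and {f g : α → Bool} (hf : PolyTime f) (hg : PolyTime g) :
    PolyTime fun a => f a && g a :=
  (cond hf hg (const false)).of_eq fun a => by cases f a <;> rfl

@[fun_prop]
theorem or {f g : α → Bool} (hf : PolyTime f) (hg : PolyTime g) :
    PolyTime fun a => f a || g a :=
  (cond hf (const true) hg).of_eq fun a => by cases f a <;> rfl

@[fun_prop]
theorem not {f : α → Bool} (hf : PolyTime f) : PolyTime fun a => !f a :=
  (cond hf (const false) (const true)).of_eq fun a => by cases f a <;> rfl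

@[fun_prop]
theorem xor {f g : α → Bool} (hf : PolyTime f) (hg : PolyTime g) :
    PolyTime fun a => f a ^^ g a :=
  (cond hf (not hg) hg).of_eq fun a => by cases f a <;> simp

/-! Lists -/

@[fun_prop]
theorem cons {f : α → β} {g : α → List β} (hf : PolyTime f) (hg : PolyTime g) :
    PolyTime fun a => f a :: g a :=
  comp (g := fun p : β × List β => p.1 :: p.2) (of_enc fun _ => rfl) (prodMk hf hg)

@[fun_prop]
theorem reverse {l : α → List β} (hl : PolyTime l) : PolyTime fun a => (l a).reverse := by
  have h (l : List β) : ∀ acc, l.foldl (fun acc b => b :: acc) acc = l.reverse ++ acc := by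
    induction l with
    | nil => simp
    | cons b l ih => simp [ih]
  have : PolyTime fun l : List β => l.foldl (fun acc b => b :: acc) [] :=
    foldl (f := fun _ acc b => b :: acc) id (const []) (by fun_prop) .id fun l l₁ hl => by
      rw [h, List.append_nil, esize_reverse]
      exact esize_le_of_prefix hl
  exact comp (g := fun l : List β => l.reverse) (this.of_eq fun l => by rw [h, List.append_nil]) hl

@[fun_prop]
theorem append {f g : α → List β} (hf : PolyTime f) (hg : PolyTime g) :
    PolyTime fun a => f a ++ g a := by
  have h (l : List β) : ∀ acc, l.foldl (fun acc b => b :: acc) acc = l.reverse ++ acc := by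
    induction l with
    | nil => simp
    | cons b l ih => simp [ih]
  have : PolyTime fun p : List β × List β => p.1.reverse.foldl (fun acc b => b :: acc) p.2 :=
    foldl (f := fun _ acc b => b :: acc) (by fun_prop) (by fun_prop) (by fun_prop) .id
      fun p l₁ hl => by
        have h1 := esize_le_of_prefix hl
        have h2 := esize_append l₁.reverse p.2
        rw [esize_reverse] at h1 h2
        rw [h]
        obtain ⟨p, q⟩ := p
        simp only [esize_prod] at *
        omega
  exact comp (g := fun p : List β × List β => p.1 ++ p.2)
    (this.of_eq fun p => by rw [h, List.reverse_reverse]) (prodMk hf hg)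

@[fun_prop]
theorem flatMap {l : α → List β} {f : α → β → List γ} (hl : PolyTime l)
    (hf : PolyTime fun p : α × β => f p.1 p.2) : PolyTime fun a => (l a).flatMap (f a) := by
  have h (a : α) (l : List β) :
      ∀ acc, l.foldl (fun acc b => acc ++ f a b) acc = acc ++ l.flatMap (f a) := by
    induction l with
    | nil => simp
    | cons b l ih => simp [ih]
  obtain ⟨c, hc⟩ := hl.esize_le
  obtain ⟨d, hd⟩ := hf.esize_le
  have hs := PolyBound.id.add (.const 2)
  have : PolyTime fun a => (l a).foldl (fun acc b => acc ++ f a b) [] :=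
    foldl (f := fun a acc b => acc ++ f a b) hl (const [])
      (append (by fun_prop) (comp (f := fun x : α × List γ × β => (x.1, x.2.2)) hf (by fun_prop)))
      (((hs.pow c).mul (((PolyBound.id.add (hs.pow c)).add (.const 3)).pow d)).add (.const 1))
      fun a l₁ hl₁ => by
        have h1 := (esize_le_of_prefix hl₁).trans (hc a)
        have h2 : ∀ b ∈ l₁, esize (f a b) ≤ (esize a + (esize a + 2) ^ c + 3) ^ d := by
          intro b hb
          refine (hd (a, b)).trans (Nat.pow_le_pow_left ?_ d)
          have := esize_le_of_mem hb
          simp only [esize_prod]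
          omega
        rw [h, List.nil_append]
        refine (esize_flatMap_le h2).trans ?_
        gcongr
        exact (length_le_esize l₁).trans h1
  exact this.of_eq fun a => by rw [h, List.nil_append]

@[fun_prop]
theorem map {l : α → List β} {f : α → β → γ} (hl : PolyTime l)
    (hf : PolyTime fun p : α × β => f p.1 p.2) : PolyTime fun a => (l a).map (f a) :=
  (flatMap (f := fun a b => [f a b]) hl (cons hf (const []))).of_eq fun a => by
    induction l a with
    | nil => rfl
    | cons b l ih => rw [List.flatMap_cons, ih]; rfl

@[fun_prop]
theorem all {l : α → List β} {f : α → β → Bool} (hl : PolyTime l)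
    (hf : PolyTime fun p : α × β => f p.1 p.2) : PolyTime fun a => (l a).all (f a) := by
  have h (a : α) (l : List β) :
      ∀ acc, l.foldl (fun acc b => acc && f a b) acc = (acc && l.all (f a)) := by
    induction l with
    | nil => simp
    | cons b l ih => simp [ih, Bool.and_assoc]
  have : PolyTime fun a => (l a).foldl (fun acc b => acc && f a b) true :=
    foldl (f := fun a acc b => acc && f a b) hl (const true)
      (and (by fun_prop) (comp (f := fun x : α × Bool × β => (x.1, x.2.2)) hf (by fun_prop)))
      (.const 3) fun a l₁ _ => esize_bool_le _
  exact this.of_eq fun a => by rw [h, Bool.true_and]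

/-- A list of constant length. -/
theorem map_const {ι : Type} (L : List ι) {f : ι → α → β} (hf : ∀ i, PolyTime (f i)) :
    PolyTime fun a => L.map fun i => f i a := by
  induction L with
  | nil => exact const []
  | cons i L ih => exact cons (hf i) ih

@[fun_prop]
theorem ofFn {r : ℕ} {f : α → Fin r → β} (hf : ∀ i, PolyTime fun a => f a i) :
    PolyTime fun a => List.ofFn (f a) :=
  (map_const (List.finRange r) hf).of_eq fun _ => (List.ofFn_eq_map).symm

/-! Numbers -/

/-- A unary numeral has the same encoding as a list of units, so iteration is a fold over that list.
-/
theorem iterate {n : α → ℕ} {init : α → γ} {f : α → γ → γ} (hn : PolyTime n)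
    (hi : PolyTime init) (hf : PolyTime fun x : α × γ => f x.1 x.2)
    {B : ℕ → ℕ} (hB : PolyBound B)
    (hsize : ∀ a m, m ≤ n a → esize ((f a)^[m] (init a)) ≤ B (esize a)) :
    PolyTime fun a => (f a)^[n a] (init a) := by
  have h (a : α) (m : ℕ) :
      ∀ acc, (List.replicate m ()).foldl (fun acc _ => f a acc) acc = (f a)^[m] acc := by
    induction m with
    | zero => simp
    | succ m ih => simp [ih, List.replicate_succ]
  have hl : PolyTime fun a => List.replicate (n a) () :=
    comp (g := fun n : ℕ => List.replicate n ()) (of_enc enc_replicate) hn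
  refine (foldl (f := fun a acc _ => f a acc) hl hi
    (comp (f := fun x : α × γ × Unit => (x.1, x.2.1)) hf (by fun_prop)) hB fun a l₁ hl₁ => ?_).of_eq
    fun a => h a _ _
  have : l₁ = List.replicate l₁.length () := List.eq_replicate_of_mem fun _ _ => rfl
  rw [this, h]
  exact hsize a _ (by simpa using hl₁.length_le)

theorem succ {f : α → ℕ} (hf : PolyTime f) : PolyTime fun a => f a + 1 :=
  comp (g := fun p : Unit × ℕ => p.2 + 1) (of_enc fun p => enc_succ p.2) (prodMk (const ()) hf)

theorem pred {f : α → ℕ} (hf : PolyTime f) : PolyTime fun a => f a - 1 := by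
  refine comp (g := fun n : ℕ => n - 1) (of_bound (p := .snd) .id fun n => ⟨_, le_rfl, ?_⟩) hf
  cases n with
  | zero => exact Runs.snd _
  | succ n => exact Runs.snd (enc (n + 1))

@[fun_prop]
theorem natAdd {f g : α → ℕ} (hf : PolyTime f) (hg : PolyTime g) :
    PolyTime fun a => f a + g a := by
  have h (m n : ℕ) : (fun k => k + 1)^[m] n = n + m := by
    induction m with
    | zero => rfl
    | succ m ih => rw [Function.iterate_succ_apply', ih]; rfl
  have : PolyTime fun p : ℕ × ℕ => (fun k => k + 1)^[p.2] p.1 :=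
    iterate (f := fun _ k => k + 1) (by fun_prop) (by fun_prop) (succ (by fun_prop)) .id
      fun p m hm => by
        obtain ⟨p, q⟩ := p
        simp only [h, esize_prod, esize_nat] at *
        omega
  exact comp (g := fun p : ℕ × ℕ => p.1 + p.2) (this.of_eq fun p => h _ _) (prodMk hf hg)

@[fun_prop]
theorem natSub {f g : α → ℕ} (hf : PolyTime f) (hg : PolyTime g) :
    PolyTime fun a => f a - g a := by
  have h (m n : ℕ) : (fun k => k - 1)^[m] n = n - m := by
    induction m with
    | zero => rfl
    | succ m ih => rw [Function.iterate_succ_apply', ih]; rfl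
  have : PolyTime fun p : ℕ × ℕ => (fun k => k - 1)^[p.2] p.1 :=
    iterate (f := fun _ k => k - 1) (by fun_prop) (by fun_prop) (pred (by fun_prop)) .id
      fun p m hm => by
        obtain ⟨p, q⟩ := p
        simp only [h, esize_prod, esize_nat] at *
        omega
  exact comp (g := fun p : ℕ × ℕ => p.1 - p.2) (this.of_eq fun p => h _ _) (prodMk hf hg)

@[fun_prop]
theorem natMul {f g : α → ℕ} (hf : PolyTime f) (hg : PolyTime g) :
    PolyTime fun a => f a * g a := by
  have h (n m : ℕ) : (fun k => k + n)^[m] 0 = n * m := by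
    induction m with
    | zero => rfl
    | succ m ih => rw [Function.iterate_succ_apply', ih]; rfl
  have : PolyTime fun p : ℕ × ℕ => (fun k => k + p.1)^[p.2] 0 :=
    iterate (f := fun (p : ℕ × ℕ) k => k + p.1) (n := fun p => p.2) (by fun_prop) (by fun_prop) (by fun_prop)
      (PolyBound.id.mul .id)
      fun p m hm => by
        obtain ⟨p, q⟩ := p
        simp only [h, esize_prod, esize_nat] at *
        have := Nat.mul_le_mul_left p hm
        nlinarith [Nat.zero_le (p * q)]
  exact comp (g := fun p : ℕ × ℕ => p.1 * p.2) (this.of_eq fun p => h _ _) (prodMk hf hg)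

@[fun_prop]
theorem decideLt {f g : α → ℕ} (hf : PolyTime f) (hg : PolyTime g) :
    PolyTime fun a => decide (f a < g a) := by
  refine (not (isNil (enc_apply (natSub hg hf)))).of_eq fun a => ?_
  rcases h : g a - f a with _ | m
  · simp only [enc_zero, Data.isNil, Bool.not_true]
    exact (decide_eq_false (by omega)).symm
  · simp only [enc_succ, Data.isNil, Bool.not_false]
    exact (decide_eq_true (by omega)).symm

@[fun_prop]
theorem decideEq {f g : α → ℕ} (hf : PolyTime f) (hg : PolyTime g) :
    PolyTime fun a => decide (f a = g a) :=
  (and (not (decideLt hf hg)) (not (decideLt hg hf))).of_eq fun a => by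
    rw [Bool.eq_iff_iff]
    simp
    omega

@[fun_prop]
theorem length {l : α → List β} (hl : PolyTime l) : PolyTime fun a => (l a).length := by
  have h (l : List β) : ∀ n : ℕ, l.foldl (fun n _ => n + 1) n = n + l.length := by
    induction l with
    | nil => simp
    | cons b l ih => intro n; simp [ih]; omega
  have : PolyTime fun l : List β => l.foldl (fun n _ => n + 1) 0 :=
    foldl (f := fun _ n _ => n + 1) id (const 0) (by fun_prop)
      (((PolyBound.const 2).mul .id).add (.const 1)) fun l l₁ hl => by
        have h1 := length_le_esize l₁
        have h2 := esize_le_of_prefix hl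
        rw [h, esize_nat]
        omega
  exact comp (g := fun l : List β => l.length) (this.of_eq fun l => by rw [h, Nat.zero_add]) hl

theorem _root_.MinSAT.esize_range_le (m : ℕ) :
    esize (List.range m) ≤ m * (2 * m + 2) + 1 := by
  have := esize_le_of_forall (l := List.range m) (M := 2 * m + 1) fun a ha => by
    rw [List.mem_range] at ha
    rw [esize_nat]
    omega
  simpa using this

@[fun_prop]
theorem range {n : α → ℕ} (hn : PolyTime n) : PolyTime fun a => List.range (n a) := by
  have h (m : ℕ) : (fun l : List ℕ => 0 :: l.map fun k => k + 1)^[m] [] = List.range m := by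
    induction m with
    | zero => rfl
    | succ m ih => rw [Function.iterate_succ_apply', ih, List.range_succ_eq_map]
  have : PolyTime fun n : ℕ => (fun l : List ℕ => 0 :: l.map fun k => k + 1)^[n] [] :=
    iterate (f := fun _ l => 0 :: l.map fun k => k + 1) id (const []) (by fun_prop)
      ((PolyBound.id.mul (.add .id (.const 2))).add (.const 1)) fun n m hm => by
        have := esize_range_le m
        rw [h, esize_nat]
        nlinarith
  exact comp (g := List.range) (this.of_eq h) hn

@[fun_prop]
theorem natPair {f g : α → ℕ} (hf : PolyTime f) (hg : PolyTime g) :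
    PolyTime fun a => Nat.pair (f a) (g a) := by
  have : PolyTime fun a => bif decide (f a < g a) then g a * g a + f a
      else f a * f a + f a + g a := by fun_prop
  exact this.of_eq fun a => by simp [Nat.pair, cond_eq_ite]

/-- Adding the carry to a number in binary. -/
def _root_.MinSAT.addCarry : Bool → List Bool → List Bool
  | c, [] => bif c then [true] else []
  | c, b :: l => (c ^^ b) :: addCarry (c && b) l

theorem _root_.MinSAT.addCarry_false (l : List Bool) : addCarry false l = l := by
  induction l with
  | nil => rfl
  | cons b l ih => simp [addCarry, ih]

theorem _root_.MinSAT.addCarry_bits (n : ℕ) : addCarry true n.bits = (n + 1).bits := by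
  induction n using Nat.binaryRec' with
  | zero => simp [addCarry]
  | bit b n h ih =>
    rw [Nat.bits_append_bit n b h]
    cases b with
    | false =>
      rw [addCarry, show Nat.bit false n + 1 = Nat.bit true n from rfl,
        Nat.bits_append_bit n true (by simp)]
      simp [addCarry_false]
    | true =>
      rw [addCarry, show Nat.bit true n + 1 = Nat.bit false (n + 1) by simp [Nat.bit]; omega,
        Nat.bits_append_bit (n + 1) false (by simp)]
      simp [ih]

theorem addCarry_true {l : α → List Bool} (hl : PolyTime l) :
    PolyTime fun a => addCarry true (l a) := by
  -- The state is the current carry and the bits produced so far, most recent first; a final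
  -- reversal restores their order.
  let step : Bool × List Bool → Bool → Bool × List Bool :=
    fun s b => (s.1 && b, (s.1 ^^ b) :: s.2)
  have h (l : List Bool) : ∀ c acc, (bif (l.foldl step (c, acc)).1
      then (true :: (l.foldl step (c, acc)).2).reverse
      else (l.foldl step (c, acc)).2.reverse) = acc.reverse ++ addCarry c l := by
    induction l with
    | nil => intro c acc; cases c <;> simp [addCarry]
    | cons b l ih => intro c acc; rw [List.foldl_cons]; simp only [ih, step]; simp [addCarry]
  have hlen (l : List Bool) : ∀ s, (l.foldl step s).2.length = s.2.length + l.length := by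
    induction l with
    | nil => simp
    | cons b l ih => intro s; simp [ih, step]; omega
  have : PolyTime fun l : List Bool => l.foldl step (true, []) :=
    foldl (f := fun _ => step) id (const _) (by fun_prop)
      ((PolyBound.id.mul (.const 4)).add (.const 5)) fun l l₁ hl => by
        have h1 := hlen l₁ (true, [])
        have h2 := hl.length_le
        have h3 := length_le_esize l
        have h4 := esize_le_of_forall (l := (l₁.foldl step (true, [])).2) (M := 3)
          fun b _ => esize_bool_le b
        have h5 := esize_bool_le (l₁.foldl step (true, [])).1
        have h6 := esize_prod (l₁.foldl step (true, [])).1 (l₁.foldl step (true, [])).2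
        rw [Prod.mk.eta] at h6
        simp only [List.length_nil] at h1
        omega
  refine comp (g := addCarry true) (PolyTime.of_eq (f := fun l => bif (l.foldl step (true, [])).1
      then (true :: (l.foldl step (true, [])).2).reverse
      else (l.foldl step (true, [])).2.reverse) ?_ fun l => ?_) hl
  · fun_prop
  · rw [h]; simp

-- Counting up from zero takes as many increments as the unary input is long.
@[fun_prop]
theorem bits {n : α → ℕ} (hn : PolyTime n) : PolyTime fun a => (n a).bits := by
  have h (m : ℕ) : (addCarry true)^[m] [] = m.bits := by
    induction m with
    | zero => simp
    | succ m ih => rw [Function.iterate_succ_apply', ih, addCarry_bits]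
  have : PolyTime fun n : ℕ => (addCarry true)^[n] [] :=
    iterate (f := fun _ => addCarry true) id (const []) (addCarry_true (by fun_prop))
      ((PolyBound.id.mul (.const 4)).add (.const 5)) fun n m hm => by
        have h4 := esize_le_of_forall (l := m.bits) (M := 3) fun b _ => esize_bool_le b
        have h5 : m.bits.length ≤ m := by
          rw [Nat.size_eq_bits_len]
          exact Nat.size_le.2 Nat.lt_two_pow_self
        rw [h, esize_nat]
        omega
  exact comp (g := Nat.bits) (this.of_eq h) hn

end PolyTime

/-! ### Deletion sets and costs -/

/-- `0` if the constraint is satisfied, `1` otherwise. -/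
noncomputable def Constraint.cost {V : Type} (C : Constraint V) (α : V → Bool) : ℕ :=
  relCost C.rel fun i => α (C.scope i)

theorem Constraint.cost_eq_zero {V : Type} {C : Constraint V} {α : V → Bool} :
    C.cost α = 0 ↔ C.Sat α := by
  simp [Constraint.cost, relCost, Constraint.Sat]

theorem Constraint.cost_le_one {V : Type} (C : Constraint V) (α : V → Bool) :
    C.cost α ≤ 1 := by
  unfold Constraint.cost relCost
  split_ifs <;> simp

/-- The number of violated constraints. -/
noncomputable def WFormula.count (F : WFormula) (α : ℕ → Bool) : ℕ :=
  (F.map fun c => c.1.cost α).sum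

/-- The weight of the violated constraints. -/
noncomputable def WFormula.weight (F : WFormula) (α : ℕ → Bool) : ℕ :=
  (F.map fun c => (c.2 : ℕ) * c.1.cost α).sum

theorem sum_map_eq_sum_get {β : Type} (l : List β) (f : β → ℕ) :
    (l.map f).sum = ∑ i, f (l.get i) := by
  conv_lhs => rw [← List.ofFn_get l, List.map_ofFn, List.sum_ofFn]
  rfl

/-- For a fixed assignment the best deletion set consists of exactly the violated constraints. -/
theorem WFormula.hasDeletionSet_iff {F : WFormula} {k W : ℕ} :
    F.HasDeletionSet k W ↔ ∃ α, F.count α ≤ k ∧ F.weight α ≤ W := by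
  simp only [WFormula.count, WFormula.weight, sum_map_eq_sum_get]
  constructor
  · rintro ⟨Z, hk, hW, α, hα⟩
    have h0 : ∀ i ∉ Z, (F.get i).1.cost α = 0 := fun i hi => Constraint.cost_eq_zero.2 (hα i hi)
    refine ⟨α, ?_, ?_⟩
    · rw [← Finset.sum_subset (Finset.subset_univ Z) fun i _ hi => h0 i hi]
      refine le_trans (Finset.sum_le_sum fun i _ => Constraint.cost_le_one _ _) ?_
      simpa using hk
    · rw [← Finset.sum_subset (Finset.subset_univ Z) fun i _ hi => by rw [h0 i hi, mul_zero]]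
      refine le_trans (Finset.sum_le_sum fun i _ => ?_) hW
      exact Nat.mul_le_of_le_div _ _ _ (by
        have := Constraint.cost_le_one (F.get i).1 α
        rw [Nat.div_self (F.get i).2.pos]; exact this) |>.trans_eq' (mul_comm _ _)
  · rintro ⟨α, hk, hW⟩
    have h1 : ∀ i ∈ Finset.univ.filter fun i => (F.get i).1.cost α ≠ 0,
        (F.get i).1.cost α = 1 := fun i hi => by
      have := Constraint.cost_le_one (F.get i).1 α
      have := (Finset.mem_filter.1 hi).2
      omega
    refine ⟨Finset.univ.filter fun i => (F.get i).1.cost α ≠ 0, ?_, ?_, α, fun i hi => ?_⟩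
    · refine le_trans ?_ hk
      rw [Finset.card_eq_sum_ones]
      exact (Finset.sum_congr rfl fun i hi => (h1 i hi).symm).trans_le
        (Finset.sum_le_sum_of_subset (Finset.subset_univ _))
    · refine le_trans ?_ hW
      refine (Finset.sum_congr rfl fun i hi => ?_).trans_le
        (Finset.sum_le_sum_of_subset (Finset.subset_univ _))
      rw [h1 i hi, mul_one]
    · exact Constraint.cost_eq_zero.1 (by simpa using hi)

/-! ### Gadgets -/

/-- Renaming the variables of a constraint. -/
def Constraint.rename {V V' : Type} (ρ : V → V') (C : Constraint V) : Constraint V' :=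
  ⟨C.arity, C.rel, ρ ∘ C.scope⟩

theorem cost_rename {V V' : Type} (ρ : V → V') (F : Formula V) (α : V' → Bool) :
    (F.map fun C => (C.rename ρ).cost α).sum = F.cost (α ∘ ρ) := rfl

/-- What the reduction needs to know about a language: an implementation of `(x = y)`, a formula
that forces `(¬x ∨ ¬y ∨ ¬z)`, and a satisfiable relation without the all-zero tuple. -/
structure Gadgets (Γ : Language) where
  eqAux : ℕ
  eqFormula : Formula (Fin 2 ⊕ Fin eqAux)
  eqCost : ℕ
  eq_over : ∀ C ∈ eqFormula, C.Over Γ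
  eqCost_pos : 0 < eqCost
  eq_isLeast : ∀ x : Fin 2 → Bool, IsLeast
    (Set.range fun y : Fin eqAux → Bool => eqFormula.cost (Sum.elim x y))
    (eqCost * relCost equal x)
  negAux : ℕ
  negFormula : Formula (Fin 3 ⊕ Fin negAux)
  neg_over : ∀ C ∈ negFormula, C.Over Γ
  neg_sat : ∀ x ∈ negClause3, ∃ y : Fin negAux → Bool, negFormula.cost (Sum.elim x y) = 0
  neg_unsat : ∀ x ∉ negClause3, ∀ y : Fin negAux → Bool, 0 < negFormula.cost (Sum.elim x y)
  arity : ℕ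
  rel : Set (Fin arity → Bool)
  rel_mem : (⟨arity, rel⟩ : Σ r : ℕ, Set (Fin r → Bool)) ∈ Γ
  tuple : Fin arity → Bool
  tuple_mem : tuple ∈ rel
  zero_notMem : (fun _ => false) ∉ rel

theorem relCost_equal (a b : Bool) : relCost equal ![a, b] = if a = b then 0 else 1 := by
  simp [relCost, equal]

/-- Proportional implementation of equality by two implications. -/
theorem proportionallyImplements_equal {Γ : Language} (h : ProportionallyImplements Γ implies) :
    ProportionallyImplements Γ equal := by
  obtain ⟨m, F, c, hF, hc, hl⟩ := h
  -- The two copies have disjoint auxiliary variables, so their minima are attained independently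
  -- and add up. The second copy swaps x and y.
  let ρ₁ : Fin 2 ⊕ Fin m → Fin 2 ⊕ Fin (m + m) :=
    Sum.elim Sum.inl fun y => Sum.inr (Fin.castAdd m y)
  let ρ₂ : Fin 2 ⊕ Fin m → Fin 2 ⊕ Fin (m + m) :=
    Sum.elim (fun i => Sum.inl (Fin.rev i)) fun y => Sum.inr (Fin.natAdd m y)
  have hcost (x : Fin 2 → Bool) (y : Fin (m + m) → Bool) :
      Formula.cost (F.map (Constraint.rename ρ₁) ++ F.map (Constraint.rename ρ₂)) (Sum.elim x y) =
      F.cost (Sum.elim x fun i => y (Fin.castAdd m i)) +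
        F.cost (Sum.elim (x ∘ Fin.rev) fun i => y (Fin.natAdd m i)) := by
    have h1 : Sum.elim x y ∘ ρ₁ = Sum.elim x fun i => y (Fin.castAdd m i) := by
      ext (i | i) <;> rfl
    have h2 : Sum.elim x y ∘ ρ₂ = Sum.elim (x ∘ Fin.rev) fun i => y (Fin.natAdd m i) := by
      ext (i | i) <;> rfl
    rw [← h1, ← h2, ← cost_rename, ← cost_rename, Formula.cost, List.map_append, List.sum_append,
      List.map_map, List.map_map]
    rfl
  have hrel (x : Fin 2 → Bool) :
      relCost equal x = relCost implies x + relCost implies (x ∘ Fin.rev) := by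
    have e (x : Fin 2 → Bool) : relCost implies x = (x 0 && !x 1).toNat := by
      rcases h0 : x 0 <;> rcases h1 : x 1 <;> simp [relCost, implies, h0, h1]
    have e' : relCost equal x = (x 0 ^^ x 1).toNat := by
      rcases h0 : x 0 <;> rcases h1 : x 1 <;> simp [relCost, equal, h0, h1]
    rw [e, e, e']
    change _ = _ + (x 1 && !x 0).toNat
    cases x 0 <;> cases x 1 <;> rfl
  refine ⟨m + m, F.map (Constraint.rename ρ₁) ++ F.map (Constraint.rename ρ₂), c, ?_, hc,
    fun x => ⟨?_, ?_⟩⟩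
  · intro C hC
    rw [List.mem_append, List.mem_map, List.mem_map] at hC
    obtain ⟨C, hC, rfl⟩ | ⟨C, hC, rfl⟩ := hC <;> exact hF C hC
  · obtain ⟨y₁, h₁⟩ := (hl x).1
    obtain ⟨y₂, h₂⟩ := (hl (x ∘ Fin.rev)).1
    refine ⟨Fin.append y₁ y₂, ?_⟩
    simp only at h₁ h₂ ⊢
    rw [hcost, hrel, mul_add, ← h₁, ← h₂]
    simp only [Fin.append_left, Fin.append_right]
  · rintro _ ⟨y, rfl⟩
    simp only
    rw [hcost, hrel, mul_add]
    exact add_le_add ((hl x).2 ⟨_, rfl⟩) ((hl (x ∘ Fin.rev)).2 ⟨_, rfl⟩)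

/-- If the all-zero alternative of triviality fails, some non-empty relation omits the all-zero
tuple; this is all that is needed to force variables to be true. Crispness is used only with bound
0, since repetition amplifies a positive cost. -/
theorem isTrivial_or_nonempty_gadgets {Γ : Language}
    (himpl : ProportionallyImplements Γ implies ∨ ProportionallyImplements Γ equal)
    (hcrisp : SupportsCrisp Γ negClause3) : IsTrivial Γ ∨ Nonempty (Gadgets Γ) := by
  obtain ⟨m, F, c, hF, hc, hl⟩ := himpl.elim proportionallyImplements_equal id
  obtain ⟨m', F', hF', hl'⟩ := hcrisp 0
  by_cases h : ∀ R ∈ Γ, R.2.Nonempty → (fun _ => false) ∈ R.2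
  · exact .inl (.inl h)
  push Not at h
  obtain ⟨⟨r, R⟩, hR, ⟨t, ht⟩, h0⟩ := h
  exact .inr ⟨⟨m, F, c, hF, hc, hl, m', F', hF', fun x => (hl' x).1, fun x => (hl' x).2,
    r, R, hR, t, ht, h0⟩⟩

/-! ### Cut instances -/

/-- Soft equations with weights (the weight is one more than the number given), hard clauses
`(¬x ∨ ¬y ∨ ¬z)` and variables that have to be true. -/
structure CutInstance where
  soft : List ((ℕ × ℕ) × ℕ)
  clauses : List (ℕ × ℕ × ℕ)
  ones : List ℕ

/-- The assignment respects the hard constraints of the instance and violates at most `K` soft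
ones, of total weight at most `W`. -/
def CutInstance.Solution (I : CutInstance) (K W : ℕ) (β : ℕ → Bool) : Prop :=
  (∀ q ∈ I.clauses, (β q.1 && β q.2.1 && β q.2.2) = false) ∧ (∀ u ∈ I.ones, β u = true) ∧
    (I.soft.map fun s => if β s.1.1 = β s.1.2 then 0 else 1).sum ≤ K ∧
    (I.soft.map fun s => if β s.1.1 = β s.1.2 then 0 else s.2 + 1).sum ≤ W

/-- The name of a variable of the cut instance in the formula. -/
def mainVar (u : ℕ) : ℕ := Nat.pair 0 u

/-- The name of an auxiliary variable of a gadget. -/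
def auxVar (tag u v w y : ℕ) : ℕ := Nat.pair tag (Nat.pair y (Nat.pair u (Nat.pair v w)))

namespace Gadgets

variable {Γ : Language} (g : Gadgets Γ)

/-- Auxiliary names depend only on the main variables. Gadgets on the same variables share them,
which is harmless: the same values are optimal for all of these gadgets. -/
def eqVars (u v : ℕ) : Fin 2 ⊕ Fin g.eqAux → ℕ :=
  Sum.elim ![mainVar u, mainVar v] fun y => auxVar 1 u v 0 y

def negVars (u v w : ℕ) : Fin 3 ⊕ Fin g.negAux → ℕ :=
  Sum.elim ![mainVar u, mainVar v, mainVar w] fun y => auxVar 2 u v w y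

def eqGadget (s : (ℕ × ℕ) × ℕ) : WFormula :=
  g.eqFormula.map fun C => (C.rename (g.eqVars s.1.1 s.1.2), s.2.succPNat)

def negGadget (q : ℕ × ℕ × ℕ) : WFormula :=
  g.negFormula.map fun C => (C.rename (g.negVars q.1 q.2.1 q.2.2), 1)

/-- A constraint that forces `u` to be true if the variable `0` is false. -/
def oneGadget (u : ℕ) : Constraint ℕ × ℕ+ :=
  (⟨g.arity, g.rel, fun i => mainVar (bif g.tuple i then u else 0)⟩, 1)

def hardFormula (I : CutInstance) : WFormula :=
  I.clauses.flatMap g.negGadget ++ I.ones.map g.oneGadget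

/-- The instance of Weighted Min SAT for a cut instance; every hard constraint is repeated so
often that it cannot be deleted. -/
def formula (I : CutInstance) (K : ℕ) : WFormula :=
  I.soft.flatMap g.eqGadget ++
    (List.range (g.eqCost * K + 1)).flatMap fun _ => g.hardFormula I

theorem over_formula (I : CutInstance) (K : ℕ) : ∀ c ∈ g.formula I K, c.1.Over Γ := by
  intro c hc
  simp only [formula, hardFormula, List.mem_append, List.mem_flatMap, List.mem_map, eqGadget,
    negGadget] at hc
  obtain ⟨s, -, C, hC, rfl⟩ | ⟨-, -, ⟨q, -, C, hC, rfl⟩ | ⟨u, -, rfl⟩⟩ := hc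
  · exact g.eq_over C hC
  · exact g.neg_over C hC
  · exact g.rel_mem

end Gadgets

theorem WFormula.count_append (F G : WFormula) (α : ℕ → Bool) :
    WFormula.count (F ++ G) α = F.count α + G.count α := by
  simp [WFormula.count]

theorem WFormula.weight_append (F G : WFormula) (α : ℕ → Bool) :
    WFormula.weight (F ++ G) α = F.weight α + G.weight α := by
  simp [WFormula.weight]

theorem WFormula.count_flatMap {β : Type} (l : List β) (f : β → WFormula) (α : ℕ → Bool) :
    WFormula.count (l.flatMap f) α = (l.map fun b => (f b).count α).sum := by
  induction l with
  | nil => rfl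
  | cons b l ih => rw [List.flatMap_cons, count_append, ih]; simp

theorem WFormula.weight_flatMap {β : Type} (l : List β) (f : β → WFormula) (α : ℕ → Bool) :
    WFormula.weight (l.flatMap f) α = (l.map fun b => (f b).weight α).sum := by
  induction l with
  | nil => rfl
  | cons b l ih => rw [List.flatMap_cons, weight_append, ih]; simp

theorem WFormula.weight_eq_zero {F : WFormula} {α : ℕ → Bool} (h : F.count α = 0) :
    F.weight α = 0 := by
  simp only [WFormula.count, WFormula.weight, List.sum_eq_zero_iff, List.mem_map,
    forall_exists_index, and_imp, forall_apply_eq_imp_iff₂] at *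
  intro c hc
  rw [h c hc, mul_zero]

namespace Gadgets

variable {Γ : Language} (g : Gadgets Γ)

theorem count_eqGadget (s : (ℕ × ℕ) × ℕ) (α : ℕ → Bool) :
    (g.eqGadget s).count α = g.eqFormula.cost (α ∘ g.eqVars s.1.1 s.1.2) := by
  rw [← cost_rename, WFormula.count, eqGadget, List.map_map]
  rfl

theorem weight_eqGadget (s : (ℕ × ℕ) × ℕ) (α : ℕ → Bool) :
    (g.eqGadget s).weight α = (s.2 + 1) * (g.eqGadget s).count α := by
  rw [WFormula.weight, WFormula.count, eqGadget, List.map_map, List.map_map,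
    ← List.sum_map_mul_left]
  rfl

theorem count_negGadget (q : ℕ × ℕ × ℕ) (α : ℕ → Bool) :
    (g.negGadget q).count α = g.negFormula.cost (α ∘ g.negVars q.1 q.2.1 q.2.2) := by
  rw [← cost_rename, WFormula.count, negGadget, List.map_map]
  rfl

theorem comp_eqVars (α : ℕ → Bool) (u v : ℕ) : α ∘ g.eqVars u v =
    Sum.elim ![α (mainVar u), α (mainVar v)] fun y : Fin _ => α (auxVar 1 u v 0 y) := by
  ext (i | i)
  · fin_cases i <;> rfl
  · rfl

theorem comp_negVars (α : ℕ → Bool) (u v w : ℕ) : α ∘ g.negVars u v w =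
    Sum.elim ![α (mainVar u), α (mainVar v), α (mainVar w)] fun y : Fin _ => α (auxVar 2 u v w y) := by
  ext (i | i)
  · fin_cases i <;> rfl
  · rfl

theorem le_count_eqGadget (s : (ℕ × ℕ) × ℕ) (α : ℕ → Bool) :
    (g.eqCost * if α (mainVar s.1.1) = α (mainVar s.1.2) then 0 else 1) ≤
      (g.eqGadget s).count α := by
  rw [count_eqGadget, comp_eqVars, ← relCost_equal]
  exact (g.eq_isLeast _).2 ⟨_, rfl⟩

theorem count_hardFormula (I : CutInstance) (α : ℕ → Bool) :
    (g.hardFormula I).count α = (I.clauses.map fun q => (g.negGadget q).count α).sum +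
      (I.ones.map fun u => (g.oneGadget u).1.cost α).sum := by
  rw [hardFormula, WFormula.count_append, WFormula.count_flatMap, WFormula.count.eq_1 (I.ones.map _),
    List.map_map]
  rfl

theorem count_formula (I : CutInstance) (K : ℕ) (α : ℕ → Bool) : (g.formula I K).count α =
    (I.soft.map fun s => (g.eqGadget s).count α).sum +
      (g.eqCost * K + 1) * (g.hardFormula I).count α := by
  rw [formula, WFormula.count_append, WFormula.count_flatMap, WFormula.count_flatMap]
  simp

theorem weight_formula (I : CutInstance) (K : ℕ) (α : ℕ → Bool) : (g.formula I K).weight α =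
    (I.soft.map fun s => (g.eqGadget s).weight α).sum +
      (g.eqCost * K + 1) * (g.hardFormula I).weight α := by
  rw [formula, WFormula.weight_append, WFormula.weight_flatMap, WFormula.weight_flatMap]
  simp

theorem solution_of_count {I : CutInstance} {K W : ℕ} (hz : (0, 0, 0) ∈ I.clauses)
    {α : ℕ → Bool} (hK : (g.formula I K).count α ≤ g.eqCost * K)
    (hW : (g.formula I K).weight α ≤ g.eqCost * W) :
    I.Solution K W fun u => α (mainVar u) := by
  rw [count_formula] at hK
  rw [weight_formula] at hW
  -- A hard constraint that is violated once is violated in all `g.eqCost * K + 1` copies, which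
  -- exceeds the budget.
  have h0 : (g.hardFormula I).count α = 0 := by
    by_contra h
    have := Nat.mul_le_mul_left (g.eqCost * K + 1) (Nat.pos_of_ne_zero h)
    omega
  rw [count_hardFormula, Nat.add_eq_zero_iff] at h0
  simp only [List.sum_eq_zero_iff, List.mem_map, forall_exists_index, and_imp,
    forall_apply_eq_imp_iff₂] at h0
  have hneg : ∀ q ∈ I.clauses,
      (α (mainVar q.1) && α (mainVar q.2.1) && α (mainVar q.2.2)) = false := by
    intro q hq
    have h := h0.1 q hq
    rw [count_negGadget, comp_negVars] at h
    by_contra hc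
    refine (g.neg_unsat _ ?_ _).ne' h
    simpa [negClause3, and_assoc] using hc
  have hz := hneg _ hz
  simp only [Bool.and_self] at hz
  refine ⟨hneg, fun u hu => ?_, ?_, ?_⟩
  · by_contra hc
    have h := Constraint.cost_eq_zero.1 (h0.2 u hu)
    refine g.zero_notMem ?_
    -- Variable 0 is false; if `u` were false too, the constraint would read the all-zero tuple.
    have he : (fun _ : Fin g.arity => false) = fun i => α ((g.oneGadget u).1.scope i) := by
      ext i
      simp only [oneGadget]
      cases g.tuple i <;> simp_all
    exact he ▸ h
  · refine Nat.le_of_mul_le_mul_left ?_ g.eqCost_pos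
    rw [← List.sum_map_mul_left]
    refine (List.sum_le_sum fun s _ => g.le_count_eqGadget s α).trans (by omega)
  · refine Nat.le_of_mul_le_mul_left ?_ g.eqCost_pos
    rw [← List.sum_map_mul_left]
    refine (List.sum_le_sum fun s _ => ?_).trans ((Nat.le_add_right _ _).trans hW)
    rw [weight_eqGadget]
    refine le_trans (le_of_eq ?_) (Nat.mul_le_mul_left (s.2 + 1) (g.le_count_eqGadget s α))
    split_ifs <;> simp [mul_comm]

theorem exists_extension (β : ℕ → Bool) : ∃ α : ℕ → Bool, (∀ u, α (mainVar u) = β u) ∧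
    (∀ s, (g.eqGadget s).count α = g.eqCost * if β s.1.1 = β s.1.2 then 0 else 1) ∧
    ∀ q : ℕ × ℕ × ℕ, (β q.1 && β q.2.1 && β q.2.2) = false → (g.negGadget q).count α = 0 := by
  choose ye hye using fun x => (g.eq_isLeast x).1
  choose! yn hyn using g.neg_sat
  -- Unpairing recovers the tag and the main variables of the gadget from a name; auxiliary
  -- variables then take optimal values for `β`. Names outside the gadgets get arbitrary values.
  let α : ℕ → Bool := fun n =>
    let r := n.unpair.2
    let y := r.unpair.1
    let u := r.unpair.2.unpair.1
    let v := r.unpair.2.unpair.2.unpair.1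
    let w := r.unpair.2.unpair.2.unpair.2
    if n.unpair.1 = 0 then β r
    else if n.unpair.1 = 1 then
      if h : y < g.eqAux then ye ![β u, β v] ⟨y, h⟩ else false
    else if h : y < g.negAux then yn ![β u, β v, β w] ⟨y, h⟩ else false
  have hmain : ∀ u, α (mainVar u) = β u := fun u => by simp [α, mainVar]
  refine ⟨α, hmain, fun s => ?_, fun q hq => ?_⟩
  · rw [count_eqGadget, comp_eqVars, hmain, hmain]
    have : (fun y : Fin g.eqAux => α (auxVar 1 s.1.1 s.1.2 0 y)) =
        ye ![β s.1.1, β s.1.2] := by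
      ext y
      simp [α, auxVar]
    rw [this, ← relCost_equal]
    exact hye _
  · rw [count_negGadget, comp_negVars, hmain, hmain, hmain]
    have : (fun y : Fin g.negAux => α (auxVar 2 q.1 q.2.1 q.2.2 y)) =
        yn ![β q.1, β q.2.1, β q.2.2] := by
      ext y
      simp [α, auxVar]
    rw [this]
    refine hyn _ ?_
    simp only [negClause3, Set.mem_ofPred_eq]
    revert hq
    simp only [Matrix.cons_val]
    cases β q.1 <;> cases β q.2.1 <;> simp

/-- A violated soft equation costs at least `g.eqCost` constraints of its weight, with equality for
optimal auxiliary values; hence both budgets scale by this factor. -/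
theorem hasDeletionSet_formula_iff {I : CutInstance} {K W : ℕ} (hz : (0, 0, 0) ∈ I.clauses) :
    (g.formula I K).HasDeletionSet (g.eqCost * K) (g.eqCost * W) ↔ ∃ β, I.Solution K W β := by
  rw [WFormula.hasDeletionSet_iff]
  refine ⟨fun ⟨α, hK, hW⟩ => ⟨_, g.solution_of_count hz hK hW⟩,
    fun ⟨β, hneg, hone, hK, hW⟩ => ?_⟩
  obtain ⟨α, hmain, heq, hn⟩ := g.exists_extension β
  have hz := hneg _ hz
  simp only [Bool.and_self] at hz
  have h0 : (g.hardFormula I).count α = 0 := by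
    rw [count_hardFormula, Nat.add_eq_zero_iff]
    simp only [List.sum_eq_zero_iff, List.mem_map, forall_exists_index, and_imp,
      forall_apply_eq_imp_iff₂]
    refine ⟨fun q hq => hn q (hneg q hq), fun u hu => Constraint.cost_eq_zero.2 ?_⟩
    have he : g.tuple = fun i => α ((g.oneGadget u).1.scope i) := by
      ext i
      simp only [oneGadget, hmain]
      have := hone u hu
      cases g.tuple i <;> simp_all
    have h := g.tuple_mem
    rw [he] at h
    exact h
  refine ⟨α, ?_, ?_⟩
  · rw [count_formula, h0]
    simp only [heq, List.sum_map_mul_left, mul_zero, add_zero]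
    exact Nat.mul_le_mul_left _ hK
  · rw [weight_formula, WFormula.weight_eq_zero h0]
    simp only [weight_eqGadget, heq, mul_zero, add_zero]
    refine le_trans (le_of_eq ?_) (Nat.mul_le_mul_left _ hW)
    rw [← List.sum_map_mul_left]
    refine congrArg List.sum (List.map_congr_left fun s _ => ?_)
    split_ifs <;> simp [mul_comm]

end Gadgets

/-! ### The cut instance of a graph -/

/-- All pairs of numbers less than `k`. -/
def pairs (k : ℕ) : List (ℕ × ℕ) :=
  (List.range k).flatMap fun i => (List.range k).map fun j => (i, j)

theorem mem_pairs {k : ℕ} {p : ℕ × ℕ} : p ∈ pairs k ↔ p.1 < k ∧ p.2 < k := by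
  obtain ⟨i, j⟩ := p
  simp [pairs]

theorem length_pairs (k : ℕ) : (pairs k).length = k * k := by
  simp [pairs, List.length_flatMap]

/-- The `e`-th variable of a chain; there are two chains, `t = 0` and `t = 1`, for each pair. -/
def chainVar (t : ℕ) (p : ℕ × ℕ) (e : ℕ) : ℕ :=
  -- The shift keeps the name 0 free for the variable that is forced to be false.
  Nat.pair (Nat.pair p.1 p.2) (Nat.pair e t) + 1

/-- Actual weights are one more than listed: n² - e on the first chain and e + 1 on the second. Cuts
at a common position always weigh n² + 1 together. -/
def cliqueSoft (n k : ℕ) : List ((ℕ × ℕ) × ℕ) :=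
  (pairs k).flatMap fun p => (List.range (n * n)).flatMap fun e =>
    [((chainVar 0 p e, chainVar 0 p (e + 1)), n * n - 1 - e),
      ((chainVar 1 p e, chainVar 1 p (e + 1)), e)]

/-- The clauses on the chains of `p` and on those of `(i, i)` and `(j, j)`, where `p = (i, j)`,
in the case that the chains of `p` are cut at the position of `q`. -/
def linkClauses (n : ℕ) (A : ℕ → ℕ → Bool) (p q : ℕ × ℕ) : List (ℕ × ℕ × ℕ) :=
  -- When both chains are cut at the same position, chain 0 at e and chain 1 at e + 1 are both true
  -- only for e equal to that position. For a non-edge this is forbidden outright.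
  (bif decide (p.1 = p.2) || A q.1 q.2 then [] else
    [(chainVar 0 p (q.1 * n + q.2), chainVar 1 p (q.1 * n + q.2 + 1),
      chainVar 1 p (q.1 * n + q.2 + 1))]) ++
  -- The third literals come in pairs: on a diagonal pair, one bounds the cut position from above
  -- and the other from below.
  [(chainVar 0 p (q.1 * n + q.2), chainVar 1 p (q.1 * n + q.2 + 1),
      chainVar 0 (p.1, p.1) (q.1 * n + q.1 + 1)),
    (chainVar 0 p (q.1 * n + q.2), chainVar 1 p (q.1 * n + q.2 + 1),
      chainVar 1 (p.1, p.1) (q.1 * n + q.1)),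
    (chainVar 0 p (q.1 * n + q.2), chainVar 1 p (q.1 * n + q.2 + 1),
      chainVar 0 (p.2, p.2) (q.2 * n + q.2 + 1)),
    (chainVar 0 p (q.1 * n + q.2), chainVar 1 p (q.1 * n + q.2 + 1),
      chainVar 1 (p.2, p.2) (q.2 * n + q.2))]

/-- The first two clauses fix the false ends of the chains. The others keep chain 1 false while
chain 0 is true, so chain 1 cannot be cut before chain 0. -/
def chainClauses (n : ℕ) (p : ℕ × ℕ) : List (ℕ × ℕ × ℕ) :=
  [(chainVar 0 p (n * n), chainVar 0 p (n * n), chainVar 0 p (n * n)),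
    (chainVar 1 p 0, chainVar 1 p 0, chainVar 1 p 0)] ++
  (List.range (n * n)).map fun e => (chainVar 0 p e, chainVar 1 p e, chainVar 1 p e)

/-- For each pair `p = (i, j)` there are two chains, which have to be cut at the same position
`u * n + v`; this stands for the choice of `u` and `v` as `i`-th and `j`-th vertex of a clique. -/
def cliqueInstance (n k : ℕ) (A : ℕ → ℕ → Bool) : CutInstance where
  soft := cliqueSoft n k
  clauses := (0, 0, 0) :: (pairs k).flatMap fun p =>
    chainClauses n p ++ (pairs n).flatMap fun q => linkClauses n A p q
  ones := (pairs k).flatMap fun p => [chainVar 0 p 0, chainVar 1 p (n * n)]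

/-! ### Boolean sequences with a single change -/

theorem sum_map_flatMap {β γ : Type} (l : List β) (f : β → List γ) (h : γ → ℕ) :
    ((l.flatMap f).map h).sum = (l.map fun b => ((f b).map h).sum).sum := by
  induction l with
  | nil => rfl
  | cons b l ih => simp [ih]

theorem sum_map_range (n : ℕ) (h : ℕ → ℕ) :
    ((List.range n).map h).sum = ∑ i ∈ Finset.range n, h i := by
  induction n with
  | zero => rfl
  | succ n ih => rw [List.range_succ, Finset.sum_range_succ, List.map_append, List.sum_append, ih]; simp

/-- The sum of the weights of the places where the sequence changes. -/
def changes (X : ℕ → Bool) (N : ℕ) (w : ℕ → ℕ) : ℕ :=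
  ∑ e ∈ Finset.range N, if X e = X (e + 1) then 0 else w e

/-- With `w` constant 1 this counts violations; with `w e = e + 1` it gives their weight. -/
theorem sum_cliqueSoft (n k : ℕ) (β : ℕ → Bool) (w : ℕ → ℕ) :
    ((cliqueSoft n k).map fun s => if β s.1.1 = β s.1.2 then 0 else w s.2).sum =
      ((pairs k).map fun p => changes (fun e => β (chainVar 0 p e)) (n * n)
          (fun e => w (n * n - 1 - e)) +
        changes (fun e => β (chainVar 1 p e)) (n * n) w).sum := by
  rw [cliqueSoft, sum_map_flatMap]
  refine congrArg List.sum (List.map_congr_left fun p _ => ?_)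
  rw [sum_map_flatMap, sum_map_range, changes, changes, ← Finset.sum_add_distrib]
  simp

theorem exists_change {X : ℕ → Bool} {N : ℕ} (h : X 0 ≠ X N) : ∃ p < N, X p ≠ X (p + 1) := by
  by_contra! hc
  have : ∀ e ≤ N, X 0 = X e := by
    intro e he
    induction e with
    | zero => rfl
    | succ e ih => rw [ih (by omega), hc e (by omega)]
  exact h (this N le_rfl)

theorem one_le_changes {X : ℕ → Bool} {N : ℕ} (h : X 0 ≠ X N) :
    1 ≤ changes X N fun _ => 1 := by
  obtain ⟨p, hp, hX⟩ := exists_change h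
  have := Finset.single_le_sum (f := fun e => if X e = X (e + 1) then 0 else 1)
    (fun _ _ => Nat.zero_le _) (Finset.mem_range.2 hp)
  rw [if_neg hX] at this
  exact this

theorem exists_cut {X : ℕ → Bool} {N : ℕ} (h : X 0 ≠ X N) (h1 : changes X N (fun _ => 1) ≤ 1) :
    ∃ p < N, (∀ e ≤ N, X e = if e ≤ p then X 0 else X N) ∧ ∀ w, changes X N w = w p := by
  obtain ⟨p, hp, hX⟩ := exists_change h
  have huniq : ∀ e < N, e ≠ p → X e = X (e + 1) := by
    intro e he hep
    by_contra hc
    have h2 : ∑ i ∈ {e, p}, (if X i = X (i + 1) then 0 else 1) ≤ 1 :=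
      (Finset.sum_le_sum_of_subset (by
        intro i hi
        simp only [Finset.mem_insert, Finset.mem_singleton] at hi
        rw [Finset.mem_range]
        omega)).trans h1
    rw [Finset.sum_pair hep] at h2
    simp [hc, hX] at h2
  have hlow : ∀ e ≤ p, X e = X 0 := by
    intro e he
    induction e with
    | zero => rfl
    | succ e ih => rw [← huniq e (by omega) (by omega), ih (by omega)]
  -- Induction downwards from `N`, on the distance to the end.
  have hhigh : ∀ d ≤ N - (p + 1), X (N - d) = X N := by
    intro d hd
    induction d with
    | zero => rfl
    | succ d ih =>
      rw [huniq (N - (d + 1)) (by omega) (by omega), ← ih (by omega)]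
      congr 1
      omega
  refine ⟨p, hp, fun e he => ?_, fun w => ?_⟩
  · split_ifs with hep
    · exact hlow e hep
    · rw [← hhigh (N - e) (by omega)]
      congr 1
      omega
  · rw [changes, Finset.sum_eq_single p]
    · simp [hX]
    · intro e he hep
      simp [huniq e (Finset.mem_range.1 he) hep]
    · simp [hp]

/-- If a sum of terms of size at least `c` is as small as possible, all terms are equal to `c`. -/
theorem eq_of_sum_map_le {β : Type} {l : List β} {f : β → ℕ} {c : ℕ} (hc : ∀ b ∈ l, c ≤ f b)
    (hs : (l.map f).sum ≤ l.length * c) : ∀ b ∈ l, f b = c := by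
  induction l with
  | nil => simp
  | cons a l ih =>
    have h1 := hc a (by simp)
    have h2 : l.length * c ≤ (l.map f).sum := by
      have := List.card_nsmul_le_sum (l.map f) c (by
        simp only [List.mem_map, forall_exists_index, and_imp, forall_apply_eq_imp_iff₂]
        exact fun b hb => hc b (by simp [hb]))
      simpa using this
    simp only [List.map_cons, List.sum_cons, List.length_cons, Nat.add_mul] at hs
    intro b hb
    rcases List.mem_cons.1 hb with rfl | hb
    · omega
    · exact ih (fun b hb => hc b (by simp [hb])) (by omega) b hb

theorem position_lt {n u v : ℕ} (hu : u < n) (hv : v < n) : u * n + v < n * n := by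
  have := Nat.mul_le_mul_right n (show u + 1 ≤ n from hu)
  rw [Nat.add_mul] at this
  omega

theorem position_inj {n u v u' v' : ℕ} (hv : v < n) (hv' : v' < n)
    (h : u * n + v = u' * n + v') : u = u' ∧ v = v' := by
  have hn : 0 < n := by omega
  have h1 : (u * n + v) / n = (u' * n + v') / n := by rw [h]
  have h2 : (u * n + v) % n = (u' * n + v') % n := by rw [h]
  rw [mul_comm u, mul_comm u', Nat.mul_add_div hn, Nat.mul_add_div hn, Nat.div_eq_of_lt hv,
    Nat.div_eq_of_lt hv'] at h1
  rw [mul_comm u, mul_comm u', Nat.mul_add_mod, Nat.mul_add_mod, Nat.mod_eq_of_lt hv,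
    Nat.mod_eq_of_lt hv'] at h2
  exact ⟨h1, h2⟩

/-! ### Cliques and solutions of the cut instance -/

theorem exists_clique_of_solution {n k : ℕ} {A : ℕ → ℕ → Bool} {β : ℕ → Bool}
    (h : (cliqueInstance n k A).Solution (2 * (k * k)) (k * k * (n * n + 1)) β) :
    ∃ f : ℕ → ℕ, (∀ i < k, f i < n) ∧ ∀ i < k, ∀ j < k, i ≠ j → A (f i) (f j) = true := by
  obtain ⟨hcl, hone, hK, hW⟩ := h
  simp only [cliqueInstance] at hcl hone hK hW
  rw [sum_cliqueSoft n k β fun _ => 1] at hK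
  rw [sum_cliqueSoft n k β fun e => e + 1] at hW
  have hx0 : ∀ p ∈ pairs k, β (chainVar 0 p 0) = true := fun p hp =>
    hone _ (List.mem_flatMap.2 ⟨p, hp, by simp⟩)
  have hyN : ∀ p ∈ pairs k, β (chainVar 1 p (n * n)) = true := fun p hp =>
    hone _ (List.mem_flatMap.2 ⟨p, hp, by simp⟩)
  have hchain : ∀ p ∈ pairs k, ∀ q ∈ chainClauses n p,
      (β q.1 && β q.2.1 && β q.2.2) = false := fun p hp q hq =>
    hcl _ (List.mem_cons_of_mem _ (List.mem_flatMap.2 ⟨p, hp, List.mem_append_left _ hq⟩))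
  have hlink : ∀ p ∈ pairs k, ∀ q ∈ pairs n, ∀ c ∈ linkClauses n A p q,
      (β c.1 && β c.2.1 && β c.2.2) = false := fun p hp q hq c hc =>
    hcl _ (List.mem_cons_of_mem _ (List.mem_flatMap.2 ⟨p, hp, List.mem_append_right _
      (List.mem_flatMap.2 ⟨q, hq, hc⟩)⟩))
  have hxN : ∀ p ∈ pairs k, β (chainVar 0 p (n * n)) = false := fun p hp => by
    simpa using hchain p hp (chainVar 0 p (n * n), chainVar 0 p (n * n), chainVar 0 p (n * n))
      (by simp [chainClauses])
  have hy0 : ∀ p ∈ pairs k, β (chainVar 1 p 0) = false := fun p hp => by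
    simpa using hchain p hp (chainVar 1 p 0, chainVar 1 p 0, chainVar 1 p 0)
      (by simp [chainClauses])
  have hxy : ∀ p ∈ pairs k, ∀ e < n * n, β (chainVar 0 p e) = true →
      β (chainVar 1 p e) = false := fun p hp e he hx => by
    simpa [hx] using hchain p hp (chainVar 0 p e, chainVar 1 p e, chainVar 1 p e)
      (List.mem_append_right _ (List.mem_map.2 ⟨e, List.mem_range.2 he, rfl⟩))
  have hx1 : ∀ p ∈ pairs k, 1 ≤ changes (fun e => β (chainVar 0 p e)) (n * n) fun _ => 1 :=
    fun p hp => one_le_changes (by simp [hx0 p hp, hxN p hp])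
  have hy1 : ∀ p ∈ pairs k, 1 ≤ changes (fun e => β (chainVar 1 p e)) (n * n) fun _ => 1 :=
    fun p hp => one_le_changes (by simp [hy0 p hp, hyN p hp])
  -- Each of the k² pairs needs two violations and the budget is 2k², so every chain is cut exactly
  -- once.
  have h2 := eq_of_sum_map_le (c := 2) (fun p hp => Nat.add_le_add (hx1 p hp) (hy1 p hp))
    (hK.trans_eq (by rw [length_pairs, mul_comm]))
  have hx : ∀ p ∈ pairs k, ∃ P < n * n, (∀ e ≤ n * n, β (chainVar 0 p e) = decide (e ≤ P)) ∧
      ∀ w, changes (fun e => β (chainVar 0 p e)) (n * n) w = w P := by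
    intro p hp
    obtain ⟨P, hP, hPe, hPw⟩ := exists_cut (X := fun e => β (chainVar 0 p e)) (N := n * n)
      (by simp [hx0 p hp, hxN p hp]) (by have := h2 p hp; have := hy1 p hp; omega)
    refine ⟨P, hP, fun e he => ?_, hPw⟩
    rw [hPe e he, hx0 p hp, hxN p hp]
    by_cases hle : e ≤ P <;> simp [hle]
  have hy : ∀ p ∈ pairs k, ∃ Q < n * n, (∀ e ≤ n * n, β (chainVar 1 p e) = decide (Q < e)) ∧
      ∀ w, changes (fun e => β (chainVar 1 p e)) (n * n) w = w Q := by
    intro p hp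
    obtain ⟨Q, hQ, hQe, hQw⟩ := exists_cut (X := fun e => β (chainVar 1 p e)) (N := n * n)
      (by simp [hy0 p hp, hyN p hp]) (by have := h2 p hp; have := hx1 p hp; omega)
    refine ⟨Q, hQ, fun e he => ?_, hQw⟩
    rw [hQe e he, hy0 p hp, hyN p hp]
    by_cases hle : e ≤ Q
    · simp [hle]
    · simp [hle, not_le.1 hle]
  choose! P hP hPe hPw using hx
  choose! Q hQ hQe hQw using hy
  -- At position `P p` chain 0 is still true, hence chain 1 is still false.
  have hPQ : ∀ p ∈ pairs k, P p ≤ Q p := by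
    intro p hp
    have h := hxy p hp (P p) (hP p hp)
    rw [hPe p hp _ (hP p hp).le, hQe p hp _ (hP p hp).le] at h
    simpa using h
  -- The weight n² - P + Q + 1 of a pair is at least n² + 1 because P ≤ Q; the budget leaves no
  -- slack, so P = Q.
  have hQP : ∀ p ∈ pairs k, Q p = P p := by
    intro p hp
    have h := eq_of_sum_map_le (c := n * n + 1) (fun p hp => ?_)
      (hW.trans_eq (by rw [length_pairs])) p hp
    · rw [hPw p hp, hQw p hp] at h
      have := hP p hp
      have := hPQ p hp
      omega
    · rw [hPw p hp, hQw p hp]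
      have := hP p hp
      have := hPQ p hp
      omega
  have hn : ∀ p ∈ pairs k, 0 < n := fun p hp => by
    rcases Nat.eq_zero_or_pos n with rfl | h
    · simpa using hP p hp
    · exact h
  have hq : ∀ p ∈ pairs k, (P p / n, P p % n) ∈ pairs n := fun p hp =>
    mem_pairs.2 ⟨Nat.div_lt_of_lt_mul (hP p hp), Nat.mod_lt _ (hn p hp)⟩
  have hpos (p : ℕ × ℕ) : P p / n * n + P p % n = P p := Nat.div_add_mod' _ _
  have hx' : ∀ p ∈ pairs k, β (chainVar 0 p (P p)) = true := fun p hp => by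
    rw [hPe p hp _ (hP p hp).le]; simp
  have hy' : ∀ p ∈ pairs k, β (chainVar 1 p (P p + 1)) = true := fun p hp => by
    rw [hQe p hp _ (hP p hp), hQP p hp]; simp
  have hdiag : ∀ i < k, ∀ u < n, β (chainVar 0 (i, i) (u * n + u + 1)) = false →
      β (chainVar 1 (i, i) (u * n + u)) = false → P (i, i) = u * n + u := by
    intro i hi u hu h0 h1
    have hp : (i, i) ∈ pairs k := mem_pairs.2 ⟨hi, hi⟩
    have hlt := position_lt hu hu
    rw [hPe _ hp _ hlt] at h0
    rw [hQe _ hp _ hlt.le, hQP _ hp] at h1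
    simp only [decide_eq_false_iff_not] at h0 h1
    omega
  have hfst : ∀ p ∈ pairs k, P (p.1, p.1) = P p / n * n + P p / n := fun p hp => by
    refine hdiag _ (mem_pairs.1 hp).1 _ (mem_pairs.1 (hq p hp)).1 ?_ ?_
    · have := hlink p hp _ (hq p hp) (chainVar 0 p (P p), chainVar 1 p (P p + 1), _)
        (List.mem_append_right _ (by simp only [hpos]; exact .head _))
      simpa [hx' p hp, hy' p hp] using this
    · have := hlink p hp _ (hq p hp) (chainVar 0 p (P p), chainVar 1 p (P p + 1), _)
        (List.mem_append_right _ (by simp only [hpos]; exact .tail _ (.head _)))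
      simpa [hx' p hp, hy' p hp] using this
  have hsnd : ∀ p ∈ pairs k, P (p.2, p.2) = P p % n * n + P p % n := fun p hp => by
    refine hdiag _ (mem_pairs.1 hp).2 _ (mem_pairs.1 (hq p hp)).2 ?_ ?_
    · have := hlink p hp _ (hq p hp) (chainVar 0 p (P p), chainVar 1 p (P p + 1), _)
        (List.mem_append_right _ (by simp only [hpos]; exact .tail _ (.tail _ (.head _))))
      simpa [hx' p hp, hy' p hp] using this
    · have := hlink p hp _ (hq p hp) (chainVar 0 p (P p), chainVar 1 p (P p + 1), _)
        (List.mem_append_right _ (by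
          simp only [hpos]; exact .tail _ (.tail _ (.tail _ (.head _)))))
      simpa [hx' p hp, hy' p hp] using this
  -- The vertex for `i` is read off the diagonal pair, with which all pairs containing `i` agree.
  refine ⟨fun i => P (i, i) / n, fun i hi => (mem_pairs.1 (hq _ (mem_pairs.2 ⟨hi, hi⟩))).1,
    fun i hi j hj hij => ?_⟩
  have hp : (i, j) ∈ pairs k := mem_pairs.2 ⟨hi, hj⟩
  obtain ⟨hu, hv⟩ := mem_pairs.1 (hq _ hp)
  have h1 : P (i, i) / n = P (i, j) / n := by
    have h := hfst _ hp
    rw [← hpos (i, i)] at h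
    exact (position_inj (Nat.mod_lt _ (hn _ hp)) hu h).1
  have h2 : P (j, j) / n = P (i, j) % n := by
    have h := hsnd _ hp
    rw [← hpos (j, j)] at h
    exact (position_inj (Nat.mod_lt _ (hn _ hp)) hv h).1
  simp only [h1, h2]
  by_contra hA
  rw [Bool.not_eq_true] at hA
  have := hlink _ hp _ (hq _ hp)
    (chainVar 0 (i, j) (P (i, j)), chainVar 1 (i, j) (P (i, j) + 1),
      chainVar 1 (i, j) (P (i, j) + 1)) (List.mem_append_left _ (by simp [hpos, hij, hA]))
  simp [hx' _ hp, hy' _ hp] at this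

theorem changes_decide_le {N D : ℕ} (hD : D < N) (w : ℕ → ℕ) :
    changes (fun e => decide (e ≤ D)) N w = w D := by
  rw [changes, Finset.sum_eq_single D]
  · simp
  · intro e _ he
    rw [if_pos]
    simp only [decide_eq_decide]
    omega
  · simp [hD]

theorem changes_decide_lt {N D : ℕ} (hD : D < N) (w : ℕ → ℕ) :
    changes (fun e => decide (D < e)) N w = w D := by
  rw [changes, Finset.sum_eq_single D]
  · simp
  · intro e _ he
    rw [if_pos]
    simp only [decide_eq_decide]
    omega
  · simp [hD]

theorem sum_map_eq_of_forall {β : Type} {l : List β} {f : β → ℕ} {c : ℕ}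
    (h : ∀ b ∈ l, f b = c) : (l.map f).sum = l.length * c := by
  rw [List.map_congr_left h]
  simp

theorem exists_solution_of_clique {n k : ℕ} {A : ℕ → ℕ → Bool} {f : ℕ → ℕ}
    (hf : ∀ i < k, f i < n) (hA : ∀ i < k, ∀ j < k, i ≠ j → A (f i) (f j) = true) :
    ∃ β, (cliqueInstance n k A).Solution (2 * (k * k)) (k * k * (n * n + 1)) β := by
  -- Both chains of a pair are cut at the position that encodes its two chosen vertices.
  let D : ℕ × ℕ → ℕ := fun p => f p.1 * n + f p.2
  let β : ℕ → Bool := fun m =>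
    let r := (m - 1).unpair
    let e := r.2.unpair.1
    bif decide (m = 0) then false
    else bif decide (r.2.unpair.2 = 0) then decide (e ≤ D r.1.unpair)
    else decide (D r.1.unpair < e)
  have h0 : β 0 = false := rfl
  have hx (p : ℕ × ℕ) (e : ℕ) : β (chainVar 0 p e) = decide (e ≤ D p) := by
    simp [β, chainVar]
  have hy (p : ℕ × ℕ) (e : ℕ) : β (chainVar 1 p e) = decide (D p < e) := by
    simp [β, chainVar]
  have hD : ∀ p ∈ pairs k, D p < n * n := fun p hp =>
    position_lt (hf _ (mem_pairs.1 hp).1) (hf _ (mem_pairs.1 hp).2)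
  refine ⟨β, ?_, ?_, ?_, ?_⟩
  · intro c hc
    simp only [cliqueInstance, List.mem_cons, List.mem_flatMap, List.mem_append] at hc
    obtain rfl | ⟨p, hp, hc | ⟨q, hq, hc⟩⟩ := hc
    · simp [h0]
    · simp only [chainClauses, List.mem_append, List.mem_cons, List.mem_map, List.mem_range,
        List.not_mem_nil, or_false] at hc
      have := hD p hp
      obtain (rfl | rfl) | ⟨e, -, rfl⟩ := hc
      · simp [hx, this]
      · simp [hy]
      · simp [hx, hy]
    · obtain ⟨hi, hj⟩ := mem_pairs.1 hp
      obtain ⟨hu, hv⟩ := mem_pairs.1 hq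
      -- The first two literals of a link clause pin the cut to the position of `q`; base-`n` digits
      -- are unique.
      have key : q.1 * n + q.2 ≤ D p → D p < q.1 * n + q.2 + 1 → q.1 = f p.1 ∧ q.2 = f p.2 :=
        fun h h' => position_inj hv (hf _ hj) (show _ = D p by omega)
      rw [linkClauses, List.mem_append] at hc
      rcases hc with hc | hc
      · by_cases hcond : (decide (p.1 = p.2) || A q.1 q.2) = true
        · rw [hcond] at hc
          simp at hc
        · rw [Bool.not_eq_true] at hcond
          rw [hcond] at hc
          simp only [cond_false, List.mem_singleton] at hc
          rw [hc, hx, hy]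
          by_contra hcon
          simp only [Bool.not_eq_false, Bool.and_eq_true, decide_eq_true_eq] at hcon
          obtain ⟨h1, h2⟩ := key hcon.1.1 hcon.1.2
          rw [Bool.or_eq_false_iff, decide_eq_false_iff_not, h1, h2] at hcond
          rw [hA _ hi _ hj hcond.1] at hcond
          simp at hcond
      · simp only [List.mem_cons, List.not_mem_nil, or_false] at hc
        obtain rfl | rfl | rfl | rfl := hc <;>
        · simp only [hx, hy]
          by_contra hcon
          simp only [Bool.not_eq_false, Bool.and_eq_true, decide_eq_true_eq] at hcon
          obtain ⟨h1, h2⟩ := key hcon.1.1 hcon.1.2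
          have h3 := hcon.2
          simp only [D, h1, h2] at h3
          omega
  · intro u hu
    simp only [cliqueInstance, List.mem_flatMap, List.mem_cons, List.not_mem_nil, or_false] at hu
    obtain ⟨p, hp, rfl | rfl⟩ := hu
    · simp [hx]
    · simp [hy, hD p hp]
  · refine le_of_eq ((sum_cliqueSoft n k β fun _ => 1).trans ?_)
    rw [sum_map_eq_of_forall (c := 2) fun p hp => ?_, length_pairs, mul_comm]
    simp only [hx, hy]
    rw [changes_decide_le (hD p hp), changes_decide_lt (hD p hp)]
  · refine le_of_eq ((sum_cliqueSoft n k β fun e => e + 1).trans ?_)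
    rw [sum_map_eq_of_forall (c := n * n + 1) fun p hp => ?_, length_pairs]
    simp only [hx, hy]
    rw [changes_decide_le (hD p hp), changes_decide_lt (hD p hp)]
    have := hD p hp
    omega

/-! ### Graphs as trees -/

/-- The entry of a matrix given by its rows, `nil` outside the matrix. -/
def Data.entry (x : Data) (i j : ℕ) : Data := (Data.snd^[j] (Data.snd^[i] x).fst).fst

theorem Data.fst_iterate_snd (x : Data) (i : ℕ) :
    (Data.snd^[i] x).fst = x.toList.getD i .nil := by
  induction i generalizing x with
  | zero => cases x <;> rfl
  | succ i ih =>
    rw [Function.iterate_succ_apply, ih]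
    cases x <;> rfl

theorem Data.entry_eq (x : Data) (i j : ℕ) :
    x.entry i j = (x.toList.getD i .nil).toList.getD j .nil := by
  rw [Data.entry, Data.fst_iterate_snd, Data.fst_iterate_snd]

/-- The number of rows of a matrix. -/
def Data.numRows (x : Data) : ℕ := x.toList.length

/-- Adjacency in the graph with the given matrix. -/
def Data.adj (x : Data) (i j : ℕ) : Bool := !(x.entry i j).isNil

/-- Is the tree the adjacency matrix of a graph? -/
def Data.isGraph (x : Data) : Bool :=
  x.toList.all (fun r => decide (r.toList.length = x.numRows)) &&
  (pairs x.numRows).all fun q =>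
    -- As `nil` has `nil` as both components, this says exactly that the entry encodes a Boolean.
    ((x.entry q.1 q.2).fst.isNil && (x.entry q.1 q.2).snd.isNil) &&
    (!(x.adj q.1 q.2 ^^ x.adj q.2 q.1) && !(decide (q.1 = q.2) && x.adj q.1 q.2))

section encodeGraph

variable {n : ℕ} (G : SimpleGraph (Fin n))

theorem numRows_encodeGraph : (encodeGraph G).numRows = n := by
  simp [Data.numRows, encodeGraph, Data.toList_ofList]

open Classical in
theorem entry_encodeGraph (i j : Fin n) :
    (encodeGraph G).entry i j = Data.ofBool (decide (G.Adj i j)) := by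
  simp [Data.entry_eq, encodeGraph, Data.toList_ofList]

theorem adj_encodeGraph (i j : Fin n) : (encodeGraph G).adj i j = true ↔ G.Adj i j := by
  rw [Data.adj, entry_encodeGraph]
  by_cases h : G.Adj i j <;> simp [h, Data.ofBool, Data.isNil]

theorem isGraph_encodeGraph : (encodeGraph G).isGraph = true := by
  rw [Data.isGraph, Bool.and_eq_true, numRows_encodeGraph]
  constructor
  · rw [List.all_eq_true]
    intro r hr
    rw [encodeGraph, Data.toList_ofList, List.mem_ofFn] at hr
    obtain ⟨i, rfl⟩ := hr
    simp [Data.toList_ofList]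
  · rw [List.all_eq_true]
    rintro ⟨i, j⟩ hq
    obtain ⟨hi, hj⟩ := mem_pairs.1 hq
    have h1 := adj_encodeGraph G ⟨i, hi⟩ ⟨j, hj⟩
    have h2 := adj_encodeGraph G ⟨j, hj⟩ ⟨i, hi⟩
    have h3 := entry_encodeGraph G ⟨i, hi⟩ ⟨j, hj⟩
    simp only at h1 h2 h3 hi hj
    have h4 : (encodeGraph G).adj i j = (encodeGraph G).adj j i := by
      rw [Bool.eq_iff_iff, h1, h2, G.adj_comm]
    simp only [Bool.and_eq_true]
    refine ⟨?_, ?_, ?_⟩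
    · rw [h3]
      by_cases h : G.Adj ⟨i, hi⟩ ⟨j, hj⟩ <;>
        simp [h, Data.ofBool, Data.fst, Data.snd, Data.isNil]
    · simp [h4]
    · by_cases hij : i = j
      · subst hij
        have : (encodeGraph G).adj i i = false := by
          rw [← Bool.not_eq_true, h1]
          exact G.irrefl
        simp [this]
      · simp [hij]

end encodeGraph

theorem Data.isNil_iff {d : Data} : d.isNil = true ↔ d = .nil := by
  cases d <;> simp [Data.isNil]

theorem Data.eq_ofBool {d : Data} (h1 : d.fst.isNil = true) (h2 : d.snd.isNil = true) :
    d = Data.ofBool (!d.isNil) := by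
  cases d with
  | nil => rfl
  | pair a b =>
    rw [Data.isNil_iff] at h1 h2
    simp only [Data.fst, Data.snd] at h1 h2
    rw [h1, h2]
    rfl

theorem exists_eq_encodeGraph {x : Data} (h : x.isGraph = true) :
    ∃ G : SimpleGraph (Fin x.numRows), x = encodeGraph G := by
  rw [Data.isGraph, Bool.and_eq_true, List.all_eq_true, List.all_eq_true] at h
  obtain ⟨hlen, hent⟩ := h
  have hent' (i j : Fin x.numRows) := hent (i, j) (mem_pairs.2 ⟨i.2, j.2⟩)
  simp only [Bool.and_eq_true] at hent'
  let G : SimpleGraph (Fin x.numRows) :=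
    { Adj := fun i j => x.adj i j = true
      symm := ⟨fun i j hij => by
        have := (hent' i j).2.1
        rw [hij] at this
        simpa using this⟩
      loopless := ⟨fun i hi => by
        have := (hent' i i).2.2
        rw [hi] at this
        simp at this⟩ }
  refine ⟨G, ?_⟩
  refine x.ofList_toList.symm.trans (congrArg Data.ofList ?_)
  refine List.ext_getElem (by simp [Data.numRows]) fun i hi _ => ?_
  have hrow := hlen _ (List.getElem_mem hi)
  rw [decide_eq_true_eq] at hrow
  rw [List.getElem_ofFn, ← x.toList[i].ofList_toList]
  congr 1
  refine List.ext_getElem (by simp [hrow]) fun j hj _ => ?_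
  have he := (hent' ⟨i, hi⟩ ⟨j, hrow ▸ hj⟩).1
  have hij : x.entry i j = x.toList[i].toList[j] := by
    rw [Data.entry_eq, List.getD_eq_getElem _ _ hi, List.getD_eq_getElem _ _ hj]
  rw [List.getElem_ofFn, ← hij, Data.eq_ofBool he.1 he.2]
  congr 1
  simp [G, Data.adj]

/-- A clique is given as an indexed family of vertices; the family is injective because adjacency is
irreflexive. -/
theorem mem_clique_iff {x : Data} {k : ℕ} : (x, k) ∈ clique ↔ x.isGraph = true ∧
    ∃ f : ℕ → ℕ, (∀ i < k, f i < x.numRows) ∧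
      ∀ i < k, ∀ j < k, i ≠ j → x.adj (f i) (f j) = true := by
  constructor
  · rintro ⟨n, G, hx, S, hS⟩
    simp only at hx hS
    subst hx
    refine ⟨isGraph_encodeGraph G, ?_⟩
    let e := S.orderEmbOfFin hS.card_eq
    refine ⟨fun i => if h : i < k then e ⟨i, h⟩ else 0, fun i hi => ?_, fun i hi j hj hij => ?_⟩
    · simp only [dif_pos hi, numRows_encodeGraph]
      exact Fin.is_lt _
    · simp only [dif_pos hi, dif_pos hj, adj_encodeGraph]
      refine hS.isClique (S.orderEmbOfFin_mem hS.card_eq _) (S.orderEmbOfFin_mem hS.card_eq _) ?_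
      exact fun h => hij (Fin.mk.inj (e.injective h))
  · rintro ⟨hx, f, hf, hadj⟩
    obtain ⟨G, hG⟩ := exists_eq_encodeGraph hx
    have hA (i j : Fin x.numRows) : x.adj i j = true ↔ G.Adj i j := by
      rw [← adj_encodeGraph G, ← hG]
    let F : Fin k → Fin x.numRows := fun i => ⟨f i, hf i i.2⟩
    have hF : ∀ i j, i ≠ j → G.Adj (F i) (F j) := fun i j hij =>
      (hA _ _).1 (hadj i i.2 j j.2 fun h => hij (Fin.ext h))
    have hinj : Function.Injective F := fun i j hij => by
      by_contra hne
      exact (hF i j hne).ne hij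
    refine ⟨_, G, hG, Finset.univ.map ⟨F, hinj⟩, ?_⟩
    rw [SimpleGraph.isNClique_iff]
    refine ⟨?_, by simp⟩
    intro u hu v hv huv
    simp only [Finset.coe_map, Function.Embedding.coeFn_mk, Finset.coe_univ, Set.image_univ,
      Set.mem_range] at hu hv
    obtain ⟨i, rfl⟩ := hu
    obtain ⟨j, rfl⟩ := hv
    exact hF i j fun h => huv (congrArg F h)

/-! ### Injectivity of the encoding of instances -/

theorem Data.ofList_injective : Function.Injective Data.ofList := fun l m h => by
  rw [← Data.toList_ofList l, h, Data.toList_ofList]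

theorem Data.ofNat_injective : Function.Injective Data.ofNat := fun m n h => by
  simpa using congrArg List.length (Data.ofList_injective h)

theorem Data.ofBool_injective : Function.Injective Data.ofBool := fun a b h => by
  cases a <;> cases b <;> first | rfl | cases h

theorem Data.ofNatBin_injective : Function.Injective Data.ofNatBin := fun m n h => by
  have h := (List.map_injective_iff.2 Data.ofBool_injective) (Data.ofList_injective h)
  exact Nat.eq_of_testBit_eq fun i => by rw [Nat.testBit_eq_inth, Nat.testBit_eq_inth, h]

theorem encodeRel_injective (r : ℕ) : Function.Injective (encodeRel r) := by
  induction r with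
  | zero =>
    intro R S h
    have h := Data.ofBool_injective h
    rw [decide_eq_decide] at h
    ext t
    rwa [Subsingleton.elim t Fin.elim0]
  | succ r ih =>
    intro R S h
    injection h with h1 h2
    ext t
    rw [← Fin.cons_self_tail t]
    cases t 0 with
    | false => exact Set.ext_iff.1 (ih h1) (Fin.tail t)
    | true => exact Set.ext_iff.1 (ih h2) (Fin.tail t)

theorem encodeConstraint_injective : Function.Injective encodeConstraint := by
  rintro ⟨r, R, s⟩ ⟨r', R', s'⟩ h
  injection h with h1 h2
  have h2 := Data.ofList_injective h2
  have hr : r = r' := by simpa using congrArg List.length h2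
  subst hr
  have hR := encodeRel_injective r h1
  have hs := List.ofFn_injective h2
  have : s = s' := funext fun i => Data.ofNat_injective (congrFun hs i)
  simp only at hR
  rw [hR, this]

/-- Membership in `weightedMinSAT` asks for some decoding of the tree. Uniqueness of the decoding is
what lets a yes-answer be read back as a solution of the constructed instance. -/
theorem encodeInstance_inj {F F' : WFormula} {W W' : ℕ}
    (h : encodeInstance F W = encodeInstance F' W') : F = F' ∧ W = W' := by
  injection h with h1 h2
  refine ⟨(List.map_injective_iff.2 fun c c' hc => ?_) (Data.ofList_injective h1),
    Data.ofNatBin_injective h2⟩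
  injection hc with h3 h4
  exact Prod.ext (encodeConstraint_injective h3) (PNat.coe_injective (Data.ofNatBin_injective h4))

/-! ### The reduction -/

noncomputable instance : Enc (Constraint ℕ) := ⟨encodeConstraint⟩
instance : Enc ℕ+ := ⟨fun n => Data.ofNatBin n⟩

/-! ### The construction runs in polynomial time -/

namespace PolyTime

variable {α β γ : Type} [Enc α] [Enc β] [Enc γ]

/-- A function with the same encoded values. -/
theorem congr_enc {f : α → β} {g : α → γ} (hf : PolyTime f) (h : ∀ a, enc (g a) = enc (f a)) :
    PolyTime g := by
  obtain ⟨p, c, hp⟩ := hf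
  exact ⟨p, c, fun a => by rw [h]; exact hp a⟩

@[fun_prop]
theorem succPNat {f : α → ℕ} (hf : PolyTime f) : PolyTime fun a => (f a).succPNat :=
  congr_enc (f := fun a => (f a + 1).bits) (by fun_prop) fun _ => rfl

/-- The relation is fixed, so its truth table is a constant built into the program; only the scope
is computed. -/
theorem constraint {r : ℕ} (R : Set (Fin r → Bool)) {f : α → Fin r → ℕ}
    (hf : ∀ i, PolyTime fun a => f a i) :
    PolyTime fun a => (⟨r, R, f a⟩ : Constraint ℕ) :=
  congr_enc (f := fun a => (encodeRel r R, List.ofFn (f a))) (by fun_prop) fun a => by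
    show Data.pair _ _ = Data.pair _ (Data.ofList ((List.ofFn (f a)).map enc))
    rw [List.map_ofFn]
    rfl

@[fun_prop]
theorem pairs {n : α → ℕ} (hn : PolyTime n) : PolyTime fun a => pairs (n a) := by
  unfold MinSAT.pairs
  fun_prop

@[fun_prop]
theorem chainVar {t : ℕ} {p : α → ℕ × ℕ} {e : α → ℕ} (hp : PolyTime p) (he : PolyTime e) :
    PolyTime fun a => chainVar t (p a) (e a) := by
  unfold MinSAT.chainVar
  fun_prop

theorem iterateSnd {n : α → ℕ} {f : α → Data} (hn : PolyTime n) (hf : PolyTime f) :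
    PolyTime fun a => Data.snd^[n a] (f a) := by
  have h (d : Data) (m : ℕ) : (Data.snd^[m] d).size ≤ d.size := by
    induction m with
    | zero => rfl
    | succ m ih => rw [Function.iterate_succ_apply']; exact (Data.size_snd_le _).trans ih
  obtain ⟨c, hc⟩ := hf.esize_le
  exact iterate (f := fun _ => Data.snd) hn hf (by fun_prop) ((PolyBound.id.add (.const 2)).pow c)
    fun a m _ => (h (f a) m).trans (hc a)

@[fun_prop]
theorem entry {f : α → Data} {i j : α → ℕ} (hf : PolyTime f) (hi : PolyTime i)
    (hj : PolyTime j) : PolyTime fun a => (f a).entry (i a) (j a) :=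
  dataFst (iterateSnd hj (dataFst (iterateSnd hi hf)))

@[fun_prop]
theorem adj {f : α → Data} {i j : α → ℕ} (hf : PolyTime f) (hi : PolyTime i)
    (hj : PolyTime j) : PolyTime fun a => (f a).adj (i a) (j a) := by
  unfold Data.adj
  fun_prop

@[fun_prop]
theorem numRows {f : α → Data} (hf : PolyTime f) : PolyTime fun a => (f a).numRows := by
  unfold Data.numRows
  fun_prop

@[fun_prop]
theorem isGraph {f : α → Data} (hf : PolyTime f) : PolyTime fun a => (f a).isGraph := by
  unfold Data.isGraph
  fun_prop

theorem cliqueSoft : PolyTime fun a : Data × ℕ => cliqueSoft a.1.numRows a.2 := by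
  unfold MinSAT.cliqueSoft
  fun_prop

theorem cliqueClauses : PolyTime fun a : Data × ℕ =>
    (cliqueInstance a.1.numRows a.2 a.1.adj).clauses := by
  unfold cliqueInstance linkClauses chainClauses
  fun_prop

theorem cliqueOnes : PolyTime fun a : Data × ℕ =>
    (cliqueInstance a.1.numRows a.2 a.1.adj).ones := by
  unfold cliqueInstance
  fun_prop

variable {Γ : Language} (g : Gadgets Γ)

@[fun_prop]
theorem mainVar {u : α → ℕ} (hu : PolyTime u) : PolyTime fun a => mainVar (u a) := by
  unfold MinSAT.mainVar
  fun_prop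

@[fun_prop]
theorem auxVar {t y : ℕ} {u v w : α → ℕ} (hu : PolyTime u) (hv : PolyTime v)
    (hw : PolyTime w) : PolyTime fun a => auxVar t (u a) (v a) (w a) y := by
  unfold MinSAT.auxVar
  fun_prop

theorem eqVars (i : Fin 2 ⊕ Fin g.eqAux) {u v : α → ℕ} (hu : PolyTime u) (hv : PolyTime v) :
    PolyTime fun a => g.eqVars (u a) (v a) i := by
  obtain i | y := i
  · fin_cases i
    · exact mainVar hu
    · exact mainVar hv
  · exact auxVar hu hv (const 0)

theorem negVars (i : Fin 3 ⊕ Fin g.negAux) {u v w : α → ℕ} (hu : PolyTime u)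
    (hv : PolyTime v) (hw : PolyTime w) : PolyTime fun a => g.negVars (u a) (v a) (w a) i := by
  obtain i | y := i
  · fin_cases i
    · exact mainVar hu
    · exact mainVar hv
    · exact mainVar hw
  · exact auxVar hu hv hw

theorem eqGadget : PolyTime g.eqGadget :=
  map_const g.eqFormula fun C =>
    prodMk (constraint C.rel fun i => eqVars g (C.scope i) (by fun_prop) (by fun_prop))
      (by fun_prop)

theorem negGadget : PolyTime g.negGadget :=
  map_const g.negFormula fun C =>
    prodMk (constraint C.rel fun i =>
      negVars g (C.scope i) (by fun_prop) (by fun_prop) (by fun_prop)) (const 1)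

theorem oneGadget : PolyTime g.oneGadget :=
  prodMk (constraint g.rel fun i => by fun_prop) (const 1)

theorem formula {I : α → CutInstance} {K : α → ℕ} (hs : PolyTime fun a => (I a).soft)
    (hc : PolyTime fun a => (I a).clauses) (ho : PolyTime fun a => (I a).ones)
    (hK : PolyTime K) : PolyTime fun a => g.formula (I a) (K a) := by
  have h1 : PolyTime fun p : α × (ℕ × ℕ) × ℕ => g.eqGadget p.2 := (eqGadget g).comp (snd id)
  have h2 : PolyTime fun p : α × ℕ × ℕ × ℕ => g.negGadget p.2 := (negGadget g).comp (snd id)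
  have h3 : PolyTime fun p : α × ℕ => g.oneGadget p.2 := (oneGadget g).comp (snd id)
  have h4 : PolyTime fun a => g.hardFormula (I a) := append (flatMap hc h2) (map ho h3)
  exact append (flatMap hs h1) (flatMap (by fun_prop) (h4.comp (fst id)))

end PolyTime

namespace Gadgets

variable {Γ : Language} (g : Gadgets Γ)

/-- The reduction from Clique to Weighted Min SAT. -/
noncomputable def reduction (a : Data × ℕ) : Data × ℕ :=
  bif a.1.isGraph then
    (encodeInstance (g.formula (cliqueInstance a.1.numRows a.2 a.1.adj) (2 * (a.2 * a.2)))
      (g.eqCost * (a.2 * a.2 * (a.1.numRows * a.1.numRows + 1))), g.eqCost * (2 * (a.2 * a.2)))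
  -- A no-instance: every encoded instance is a pair, never `nil`.
  else (.nil, 0)

theorem polyTime_reduction : PolyTime g.reduction := by
  have hF : PolyTime fun a : Data × ℕ =>
      g.formula (cliqueInstance a.1.numRows a.2 a.1.adj) (2 * (a.2 * a.2)) :=
    PolyTime.formula g PolyTime.cliqueSoft PolyTime.cliqueClauses PolyTime.cliqueOnes
      (by fun_prop)
  have hI : PolyTime fun a : Data × ℕ => encodeInstance
      (g.formula (cliqueInstance a.1.numRows a.2 a.1.adj) (2 * (a.2 * a.2)))
      (g.eqCost * (a.2 * a.2 * (a.1.numRows * a.1.numRows + 1))) :=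
    PolyTime.congr_enc (f := fun a : Data × ℕ =>
      (g.formula (cliqueInstance a.1.numRows a.2 a.1.adj) (2 * (a.2 * a.2)),
        (g.eqCost * (a.2 * a.2 * (a.1.numRows * a.1.numRows + 1))).bits)) (by fun_prop)
      fun _ => rfl
  unfold reduction
  fun_prop

theorem reduction_mem_iff (x : Data) (k : ℕ) :
    (x, k) ∈ clique ↔ g.reduction (x, k) ∈ weightedMinSAT Γ := by
  rw [mem_clique_iff, reduction]
  cases hx : x.isGraph with
  | false =>
    refine ⟨fun h => absurd h.1 (by simp), ?_⟩
    rintro ⟨F, W, h, -⟩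
    cases h
  | true =>
    have hz : (0, 0, 0) ∈ (cliqueInstance x.numRows k x.adj).clauses := .head _
    constructor
    · rintro ⟨-, f, hf, hA⟩
      exact ⟨_, _, rfl, g.over_formula _ _,
        (g.hasDeletionSet_formula_iff hz).2 (exists_solution_of_clique hf hA)⟩
    · rintro ⟨F, W, h, -, hdel⟩
      obtain ⟨rfl, rfl⟩ := encodeInstance_inj h
      obtain ⟨β, hβ⟩ := (g.hasDeletionSet_formula_iff hz).1 hdel
      exact ⟨rfl, exists_clique_of_solution hβ⟩

theorem fptReducible (g : Gadgets Γ) : FPTReducible clique (weightedMinSAT Γ) := by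
  obtain ⟨p, c, hp⟩ := g.polyTime_reduction
  have hlin (a b : ℕ) : Computable fun k : ℕ => a * k + b :=
    Primrec.nat_add.to_comp.comp (Primrec.nat_mul.to_comp.comp (.const a) .id) (.const b)
  refine ⟨fun x k => g.reduction (x, k), p, fun k => (2 * k + 5) ^ c,
    fun k => g.eqCost * (2 * (k * k)), c, computable_pow_const (hlin 2 5) c, ?_,
    fun x k => ⟨?_, ?_, g.reduction_mem_iff x k⟩⟩
  · exact Primrec.nat_mul.to_comp.comp (.const _) (Primrec.nat_mul.to_comp.comp (.const 2)
      (Primrec.nat_mul.to_comp.comp .id .id))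
  · obtain ⟨t, ht, hr⟩ := hp (x, k)
    refine ⟨t, ht.trans ?_, hr⟩
    rw [← mul_pow]
    -- The input has size |x| + 2k + 2, and |x| + 2k + 4 ≤ (2k + 5)|x| because |x| ≥ 1.
    refine Nat.pow_le_pow_left ?_ c
    rw [esize_prod, esize_nat, esize_data]
    nlinarith [x.size_pos]
  · simp only [reduction]
    cases x.isGraph <;> simp

end Gadgets

end MinSAT

theorem mainTheorem11 (Γ : MinSAT.Language)
    (himpl : MinSAT.ProportionallyImplements Γ MinSAT.implies ∨
      MinSAT.ProportionallyImplements Γ MinSAT.equal)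
    (hcrisp : MinSAT.SupportsCrisp Γ MinSAT.negClause3) :
    MinSAT.IsTrivial Γ ∨ MinSAT.W1Hard (MinSAT.weightedMinSAT Γ) :=
  (MinSAT.isTrivial_or_nonempty_gadgets himpl hcrisp).imp_right fun ⟨g⟩ =>
    MinSAT.w1Hard_of_clique g.fptReducible
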